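/- All graphs are finite and simple. For a graph $H$ and an integer $i\ge 1$, let $c_i(H)$ denote the number of connected components of $H$ having exactly $i$ vertices; for $X\subseteq V(G)$, let $G-X$ be the graph obtained from $G$ by deleting the vertices in $X$. Let $P_n$ be the path with $n$ vertices. A $\{P_2,P_7\}$-factor of $G$ is a spanning subgraph $F$ of $G$ such that each connected component of $F$ is isomorphic to $P_2$ or $P_7$. **Theorem.** Let $G$ be a graph. If $$c_1(G-X)+\tfrac13 c_3(G-X)+\tfrac13 c_5(G-X)\le \tfrac23|X|\quad\text{for all } X\subseteq V(G),$$ then $G$ has a $\{P_2,P_7\}$-factor. -/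

import Mathlib

namespace PathFactor

/-- The number `c_i(H)` of connected components of `H` with exactly `i` vertices. -/
noncomputable def numComponents {W : Type*} (H : SimpleGraph W) (i : ℕ) : ℕ :=
  {C : H.ConnectedComponent | C.supp.ncard = i}.ncard

/-- The graph `G - X` obtained from `G` by deleting the vertices in `X`. -/
abbrev deleteVerts {V : Type*} (G : SimpleGraph V) (X : Set V) : SimpleGraph (Xᶜ : Set V) :=
  G.induce Xᶜ

/-- `F` is an `𝓗`-factor of `G`: a spanning subgraph of `G` (a graph on the same vertex set, all
of whose edges are edges of `G`) each of whose components is isomorphic to a graph in `𝓗`. -/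
def IsFactor {V : Type*} (𝓗 : Set (Σ n : ℕ, SimpleGraph (Fin n))) (G F : SimpleGraph V) : Prop :=
  F ≤ G ∧ ∀ C : F.ConnectedComponent, ∃ H ∈ 𝓗, Nonempty (C.toSimpleGraph ≃g H.2)

/-- The path `P_n` of order `n`. -/
def path (n : ℕ) : Σ n : ℕ, SimpleGraph (Fin n) :=
  ⟨n, SimpleGraph.pathGraph n⟩

end PathFactor

/-! Choose a barrier `S` with disjoint odd parts maximizing the number of parts minus `|S|`, and
among these one with `S` largest. As in the Gallai–Edmonds theorem, every part is factor-critical,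
everything else has a perfect matching, and `S` satisfies Hall's condition into the parts. A part
together with one adjacent vertex of `S` is perfectly matched, so the trouble lies in parts left
over by a matching of `S` that have no tiling of their own.

Such parts are rare. An untileable factor-critical part has order 1, 3 or 5, or is a windmill
(`FactorCritical.windmill`). In each case some deletion set `U` inside it leaves small components of
total weight at least `2|U|` plus a demand: 2 for a singleton, 1 otherwise
(`FactorCritical.exists_heavy`). The hypothesis, multiplied by three, bounds the weight of small
components by `2|X|`. Applied to all the sets `U` together with the neighbours of the parts in `S`,
it shows that untileable parts of total demand `d` have at least `d/2` neighbours in `S`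
(`sum_demand_le`).

A doubled Hall argument then gives two matchings (`exists_two_matchings`): `m` from `S` into the
parts, hitting all singletons, and `n` sending the singletons, and the untileable parts missed by
`m`, injectively to neighbours in `S`. Let `T` be a missed untileable part and `s = n T`. If `m s`
is not a singleton, three vertices of `T`, then `s`, then three vertices of `m s` form a `P₇`. If `m
s = {t}`, put `r = n {t}`: three vertices of `T`, then `s`, `t`, `r` and one vertex of `m r` form a
`P₇`. Factor-criticality matches what remains by edges. -/

namespace PathFactor

open Finset Function

variable {V : Type*}

/-! ### Matchings, tilings and factors -/

/-- `μ` is the partner map of a perfect matching of `A` in `G`. -/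
def IsPartner (G : SimpleGraph V) (A : Finset V) (μ : V → V) : Prop :=
  ∀ a ∈ A, μ a ∈ A ∧ μ (μ a) = a ∧ G.Adj a (μ a)

/-- `A` has a perfect matching in `G`. -/
def Matched (G : SimpleGraph V) (A : Finset V) : Prop :=
  ∃ μ : V → V, IsPartner G A μ

/-- `A` is the vertex set of a (not necessarily induced) path of order two or seven in `G`. -/
def IsPiece (G : SimpleGraph V) (A : Finset V) : Prop :=
  ∃ n, (n = 2 ∨ n = 7) ∧ ∃ f : Fin n → V, Injective f ∧
    (∀ i j, (SimpleGraph.pathGraph n).Adj i j → G.Adj (f i) (f j)) ∧ ∀ v, v ∈ A ↔ ∃ i, f i = v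

/-- `A` can be partitioned into vertex sets of paths of order two or seven in `G`. -/
def Tileable [DecidableEq V] (G : SimpleGraph V) (A : Finset V) : Prop :=
  ∃ P : Finset (Finset V), (∀ p ∈ P, IsPiece G p) ∧
    (P : Set (Finset V)).PairwiseDisjoint id ∧ P.biUnion id = A

/-- Keep only the edges of the chosen paths. Since the pieces are disjoint, no kept edge leaves a
piece, so the components are exactly the paths. -/
theorem Tileable.exists_isFactor [Fintype V] [DecidableEq V] {G : SimpleGraph V}
    (h : Tileable G Finset.univ) : ∃ F : SimpleGraph V, IsFactor {path 2, path 7} G F := by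
  obtain ⟨P, hP, hdis, hun⟩ := h
  have hP' : ∀ p : Finset V, ∃ n, ∃ f : Fin n → V, p ∈ P → (n = 2 ∨ n = 7) ∧ Injective f ∧
      (∀ i j, (SimpleGraph.pathGraph n).Adj i j → G.Adj (f i) (f j)) ∧
      ∀ v, v ∈ p ↔ ∃ i, f i = v := by
    intro p
    by_cases hp : p ∈ P
    · obtain ⟨n, hn, f, hf⟩ := hP p hp
      exact ⟨n, f, fun _ => ⟨hn, hf⟩⟩
    · exact ⟨0, Fin.elim0, fun h => absurd h hp⟩
  choose n f hf using hP'
  have hn := fun p hp => (hf p hp).1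
  have hinj := fun p hp => (hf p hp).2.1
  have hadj := fun p hp => (hf p hp).2.2.1
  have hmem := fun p hp => (hf p hp).2.2.2
  let F : SimpleGraph V :=
    { Adj := fun x y => ∃ p ∈ P, ∃ i j, (SimpleGraph.pathGraph (n p)).Adj i j ∧ f p i = x ∧ f p j = y
      symm := ⟨by
        rintro x y ⟨p, hp, i, j, hij, rfl, rfl⟩
        exact ⟨p, hp, j, i, hij.symm, rfl, rfl⟩⟩
      loopless := ⟨by
        rintro x ⟨p, hp, i, j, hij, hi, hj⟩
        exact hij.ne (hinj p hp (hi.trans hj.symm))⟩ }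
  have same : ∀ p ∈ P, ∀ q ∈ P, ∀ v, v ∈ p → v ∈ q → p = q := by
    intro p hp q hq v hvp hvq
    by_contra hne
    exact Finset.disjoint_left.mp (hdis hp hq hne) hvp hvq
  have hF : ∀ p ∈ P, ∀ i j, F.Adj (f p i) (f p j) ↔ (SimpleGraph.pathGraph (n p)).Adj i j := by
    intro p hp i j
    constructor
    · rintro ⟨q, hq, i', j', hij, hi, hj⟩
      obtain rfl := same p hp q hq (f p i) ((hmem p hp _).2 ⟨i, rfl⟩) ((hmem q hq _).2 ⟨i', hi⟩)
      rwa [hinj p hp hi, hinj p hp hj] at hij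
    · exact fun hij => ⟨p, hp, i, j, hij, rfl, rfl⟩
  have hclosed : ∀ p ∈ P, ∀ u v, F.Reachable u v → u ∈ p → v ∈ p := by
    intro p hp u v huv hu
    obtain ⟨w⟩ := huv
    induction w with
    | nil => exact hu
    | cons hadj' _ ih =>
      apply ih
      obtain ⟨q, hq, i', j', hij, hi, hj⟩ := hadj'
      obtain rfl := same p hp q hq _ hu ((hmem q hq _).2 ⟨i', hi⟩)
      exact (hmem p hp _).2 ⟨j', hj⟩
  have hconn : ∀ p ∈ P, ∀ i j, F.Reachable (f p i) (f p j) := by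
    intro p hp i j
    have hpos : 0 < n p := i.pos
    have hc : (SimpleGraph.pathGraph (n p)).Connected := by
      obtain ⟨m, hm⟩ := Nat.exists_eq_succ_of_ne_zero hpos.ne'
      rw [hm]
      exact SimpleGraph.pathGraph_connected m
    let φ : SimpleGraph.pathGraph (n p) →g F := ⟨f p, fun h => (hF p hp _ _).2 h⟩
    exact (hc.preconnected i j).map φ
  refine ⟨F, ?_, ?_⟩
  · rintro x y ⟨p, hp, i, j, hij, rfl, rfl⟩
    exact hadj p hp i j hij
  · intro C
    obtain ⟨v, rfl⟩ := C.exists_rep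
    have hv : v ∈ P.biUnion id := hun ▸ Finset.mem_univ v
    obtain ⟨p, hp, hvp⟩ := Finset.mem_biUnion.1 hv
    have hvp : v ∈ p := hvp
    obtain ⟨i₀, hi₀⟩ := (hmem p hp v).1 hvp
    have hsupp : ∀ u, F.connectedComponentMk u = F.connectedComponentMk v ↔ ∃ i, f p i = u := by
      intro u
      rw [SimpleGraph.ConnectedComponent.eq]
      constructor
      · exact fun h => (hmem p hp u).1 (hclosed p hp v u h.symm hvp)
      · rintro ⟨i, rfl⟩
        rw [← hi₀]
        exact hconn p hp i i₀
    have key : Nonempty ((F.connectedComponentMk v).toSimpleGraph ≃g SimpleGraph.pathGraph (n p)) := by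
      let e : Fin (n p) ≃ (F.connectedComponentMk v) :=
        Equiv.ofBijective (fun i => ⟨f p i, (hsupp _).2 ⟨i, rfl⟩⟩)
          ⟨fun i j hij => hinj p hp (congrArg Subtype.val hij), by
            rintro ⟨u, hu⟩
            obtain ⟨i, hi⟩ := (hsupp u).1 hu
            exact ⟨i, Subtype.ext hi⟩⟩
      refine ⟨(RelIso.mk e ?_).symm⟩
      intro i j
      exact hF p hp i j
    rcases hn p hp with h | h
    · exact ⟨path 2, by simp, by rw [h] at key; exact key⟩
    · exact ⟨path 7, by simp, by rw [h] at key; exact key⟩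

theorem Matched.even_card {G : SimpleGraph V} {A : Finset V} (h : Matched G A) : Even A.card := by
  obtain ⟨μ, hμ⟩ := h
  have : ∑ a ∈ A, (1 : ZMod 2) = 0 :=
    Finset.sum_involution (fun a _ => μ a) (fun _ _ => by decide)
      (fun a ha _ => (hμ a ha).2.2.ne') (fun a ha => (hμ a ha).1) (fun a ha => (hμ a ha).2.1)
  rw [Finset.sum_const, nsmul_eq_mul, mul_one] at this
  exact (ZMod.natCast_eq_zero_iff_even).1 this

/-! ### Building tilings from edges and seven-vertex paths -/

section Tile

variable [DecidableEq V] {G : SimpleGraph V}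

theorem IsPiece.tileable {A : Finset V} (h : IsPiece G A) : Tileable G A :=
  ⟨{A}, by simpa using h, by simp, by simp⟩

theorem tileable_empty : Tileable G (∅ : Finset V) :=
  ⟨∅, by simp, by simp, by simp⟩

theorem Tileable.union {A B : Finset V} (hA : Tileable G A) (hB : Tileable G B)
    (hAB : Disjoint A B) : Tileable G (A ∪ B) := by
  obtain ⟨P, hP, hPd, rfl⟩ := hA
  obtain ⟨Q, hQ, hQd, rfl⟩ := hB
  refine ⟨P ∪ Q, ?_, ?_, ?_⟩
  · intro p hp
    rcases Finset.mem_union.1 hp with h | h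
    exacts [hP p h, hQ p h]
  · rw [Finset.coe_union, Set.pairwiseDisjoint_union]
    refine ⟨hPd, hQd, fun p hp q hq _ => ?_⟩
    exact hAB.mono (Finset.subset_biUnion_of_mem id hp) (Finset.subset_biUnion_of_mem id hq)
  · exact Finset.union_biUnion

theorem Tileable.biUnion {ι : Type*} {I : Finset ι} {A : ι → Finset V}
    (h : ∀ i ∈ I, Tileable G (A i)) (hd : (I : Set ι).PairwiseDisjoint A) :
    Tileable G (I.biUnion A) := by
  classical
  induction I using Finset.induction_on with
  | empty => simpa using tileable_empty
  | insert i I hi ih =>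
    rw [Finset.biUnion_insert]
    refine (h i (by simp)).union (ih (fun j hj => h j (by simp [hj])) (hd.subset (by simp))) ?_
    rw [Finset.disjoint_biUnion_right]
    intro j hj
    exact hd (by simp) (by simp [hj]) (by rintro rfl; exact hi hj)

theorem isPiece_pair {a b : V} (h : G.Adj a b) : IsPiece G {a, b} := by
  refine ⟨2, Or.inl rfl, ![a, b], ?_, ?_, ?_⟩
  · intro i j
    have := h.ne
    fin_cases i <;> fin_cases j <;> simp [this, this.symm]
  · intro i j
    fin_cases i <;> fin_cases j <;> simp [SimpleGraph.pathGraph_adj, h, h.symm]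
  · intro v
    simp [eq_comm]

theorem Matched.tileable {A : Finset V} (h : Matched G A) : Tileable G A := by
  obtain ⟨μ, hμ⟩ := h
  refine ⟨A.image fun a => {a, μ a}, ?_, ?_, ?_⟩
  · intro p hp
    obtain ⟨a, ha, rfl⟩ := Finset.mem_image.1 hp
    exact isPiece_pair (hμ a ha).2.2
  · intro p hp q hq hne
    obtain ⟨a, ha, rfl⟩ := Finset.mem_image.1 (Finset.mem_coe.1 hp)
    obtain ⟨b, hb, rfl⟩ := Finset.mem_image.1 (Finset.mem_coe.1 hq)
    have h1 := (hμ a ha).2.1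
    have h2 := (hμ b hb).2.1
    rw [Function.onFun, id, id, Finset.disjoint_left]
    intro x hx hy
    apply hne
    simp only [Finset.mem_insert, Finset.mem_singleton] at hx hy
    rcases hx with rfl | rfl <;> rcases hy with h | h
    · rw [h]
    · subst h; rw [h2, Finset.pair_comm]
    · rw [← h, h1, Finset.pair_comm]
    · rw [← h1, h, h2, Finset.pair_comm]
  · ext v
    simp only [Finset.mem_biUnion, Finset.mem_image, id]
    constructor
    · rintro ⟨p, ⟨a, ha, rfl⟩, hv⟩
      simp only [Finset.mem_insert, Finset.mem_singleton] at hv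
      rcases hv with rfl | rfl
      exacts [ha, (hμ a ha).1]
    · exact fun hv => ⟨_, ⟨v, hv, rfl⟩, by simp⟩

theorem isPiece_seven {l : List V} (hl : l.length = 7) (hnd : l.Nodup) (hc : l.IsChain G.Adj) :
    IsPiece G l.toFinset := by
  refine ⟨7, Or.inr rfl, fun i => l.get (i.cast hl.symm), ?_, ?_, ?_⟩
  · intro i j hij
    have := (List.nodup_iff_injective_get.1 hnd) hij
    simpa using this
  · intro i j hij
    rw [SimpleGraph.pathGraph_adj] at hij
    rw [List.isChain_iff_getElem] at hc
    rcases hij with h | h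
    · have := hc i (by omega)
      simp only [List.get_eq_getElem, Fin.val_cast]
      convert this using 2
      exact h.symm
    · have := hc j (by omega)
      simp only [List.get_eq_getElem, Fin.val_cast]
      convert this.symm using 2
      exact h.symm
  · intro v
    rw [List.mem_toFinset, List.mem_iff_get]
    constructor
    · rintro ⟨i, rfl⟩
      exact ⟨i.cast hl, rfl⟩
    · rintro ⟨i, rfl⟩
      exact ⟨_, rfl⟩

/-- A path of order seven inside `A` whose complement in `A` is matched gives a tiling of `A`. -/
theorem tileable_of_seven {A : Finset V} {l : List V} (hl : l.length = 7) (hnd : l.Nodup)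
    (hc : l.IsChain G.Adj) (hlA : ∀ x ∈ l, x ∈ A) (hM : Matched G (A \ l.toFinset)) :
    Tileable G A := by
  have := (isPiece_seven hl hnd hc).tileable.union hM.tileable Finset.disjoint_sdiff
  rwa [Finset.union_sdiff_of_subset (fun x hx => hlA x (List.mem_toFinset.1 hx))] at this

theorem matched_pair {a b : V} (h : G.Adj a b) : Matched G {a, b} := by
  refine ⟨fun x => if x = a then b else a, ?_⟩
  have := h.ne
  intro x hx
  simp only [Finset.mem_insert, Finset.mem_singleton] at hx
  rcases hx with rfl | rfl
  · simp [this.symm, h]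
  · simp [this.symm, h.symm]

theorem Matched.union {A B : Finset V} (hA : Matched G A) (hB : Matched G B)
    (hAB : Disjoint A B) : Matched G (A ∪ B) := by
  obtain ⟨μ, hμ⟩ := hA
  obtain ⟨ν, hν⟩ := hB
  refine ⟨fun x => if x ∈ A then μ x else ν x, fun a ha => ?_⟩
  by_cases h : a ∈ A
  · obtain ⟨h1, h2, h3⟩ := hμ a h
    simp [h, h1, h2, h3]
  · have hb : a ∈ B := (Finset.mem_union.1 ha).resolve_left h
    obtain ⟨h1, h2, h3⟩ := hν a hb
    have := Finset.disjoint_right.1 hAB h1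
    simp [h, h1, h2, h3, this]

end Tile

/-! ### Factor-critical sets without a tiling -/

/-- `A` is nonempty and `A` minus any one of its vertices has a perfect matching. -/
def FactorCritical [DecidableEq V] (G : SimpleGraph V) (A : Finset V) : Prop :=
  A.Nonempty ∧ ∀ v ∈ A, Matched G (A.erase v)

/-- No proper nonempty subset of `A` is closed under adjacency within `A`. -/
def Linked (G : SimpleGraph V) (A : Finset V) : Prop :=
  ∀ W ⊆ A, W.Nonempty → (∀ a ∈ W, ∀ b ∈ A, G.Adj a b → b ∈ W) → W = A

theorem IsPartner.matched_subset {G : SimpleGraph V} {A : Finset V} {μ : V → V} (hμ : IsPartner G A μ)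
    {B : Finset V} (hB : B ⊆ A) (h : ∀ b ∈ B, μ b ∈ B) : Matched G B :=
  ⟨μ, fun b hb => ⟨h b hb, (hμ b (hB hb)).2⟩⟩

theorem linked_singleton {G : SimpleGraph V} (v : V) : Linked G {v} := by
  intro W hW hne _
  exact (Finset.subset_singleton_iff.1 hW).resolve_left hne.ne_empty

section FactorCritical

variable [DecidableEq V] {G : SimpleGraph V} {A : Finset V}

theorem FactorCritical.odd_card (h : FactorCritical G A) : Odd A.card := by
  obtain ⟨v, hv⟩ := h.1
  have := (h.2 v hv).even_card
  rw [Finset.card_erase_of_mem hv] at this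
  have hpos := Finset.card_pos.2 h.1
  rw [← Nat.sub_add_cancel hpos]
  exact this.add_one

/-- Parity: were `W` closed and proper, a matching missing `v ∈ W` would restrict to `W.erase v`,
and one missing a vertex outside `W` would restrict to `W`. These sets cannot both be even. -/
theorem FactorCritical.linked (h : FactorCritical G A) : Linked G A := by
  intro W hW hne hcl
  by_contra hWA
  obtain ⟨v, hv⟩ := hne
  obtain ⟨u, hu, huW⟩ : ∃ u ∈ A, u ∉ W := by
    by_contra! hcon
    exact hWA (hW.antisymm hcon)
  obtain ⟨μ, hμ⟩ := h.2 v (hW hv)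
  obtain ⟨ν, hν⟩ := h.2 u hu
  have h1 : Matched G (W.erase v) := by
    refine IsPartner.matched_subset hμ (Finset.erase_subset_erase v hW) fun b hb => ?_
    have hbA := Finset.erase_subset_erase v hW hb
    obtain ⟨h1, h2, h3⟩ := hμ b hbA
    have := hcl b (Finset.mem_of_mem_erase hb) (μ b) (Finset.mem_of_mem_erase h1) h3
    exact Finset.mem_erase.2 ⟨Finset.ne_of_mem_erase h1, this⟩
  have h2 : Matched G W := by
    have hWu : W ⊆ A.erase u := fun b hb =>
      Finset.mem_erase.2 ⟨by rintro rfl; exact huW hb, hW hb⟩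
    refine IsPartner.matched_subset hν hWu fun b hb => ?_
    obtain ⟨h1, h2, h3⟩ := hν b (hWu hb)
    exact hcl b hb (ν b) (Finset.mem_of_mem_erase h1) h3
  have e1 := h1.even_card
  have e2 := h2.even_card
  rw [Finset.card_erase_of_mem hv] at e1
  have hpos := Finset.card_pos.2 ⟨v, hv⟩
  grind

theorem Linked.exists_adj (h : Linked G A) {W : Finset V} (hW : W ⊆ A) (hne : W.Nonempty)
    (hcard : W.card < A.card) : ∃ g ∈ W, ∃ p ∈ A, p ∉ W ∧ G.Adj g p := by
  by_contra! hcon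
  have := h W hW hne fun a ha b hb hab => by
    by_contra hbW
    exact hcon a ha b hb hbW hab
  rw [this] at hcard
  exact lt_irrefl _ hcard

/-- If the path contains the unmatched vertex `c` and is closed under `μ` elsewhere, then `μ` still
matches its complement. -/
theorem IsPartner.tileable_of_seven {c : V} {μ : V → V} (hμ : IsPartner G (A.erase c) μ)
    {l : List V} (hl : l.length = 7) (hnd : l.Nodup) (hc : l.IsChain G.Adj)
    (hlA : ∀ x ∈ l, x ∈ A) (hcl : c ∈ l) (hμl : ∀ x ∈ l, x ≠ c → μ x ∈ l) : Tileable G A := by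
  refine PathFactor.tileable_of_seven hl hnd hc hlA (hμ.matched_subset ?_ ?_)
  · intro b hb
    rw [Finset.mem_sdiff, List.mem_toFinset] at hb
    exact Finset.mem_erase.2 ⟨by rintro rfl; exact hb.2 hcl, hb.1⟩
  · intro b hb
    rw [Finset.mem_sdiff, List.mem_toFinset] at hb ⊢
    have hbc : b ≠ c := by rintro rfl; exact hb.2 hcl
    obtain ⟨h1, h2, h3⟩ := hμ b (Finset.mem_erase.2 ⟨hbc, hb.1⟩)
    refine ⟨Finset.mem_of_mem_erase h1, fun h => hb.2 ?_⟩
    have := hμl _ h (Finset.ne_of_mem_erase h1)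
    rwa [h2] at this

theorem IsPartner.erase_iff {c : V} {μ : V → V} : IsPartner G (A.erase c) μ ↔
    ∀ a, a ∈ A → a ≠ c → μ a ∈ A ∧ μ a ≠ c ∧ μ a ≠ a ∧ μ (μ a) = a ∧ G.Adj a (μ a) := by
  constructor
  · intro h a ha hac
    obtain ⟨h1, h2, h3⟩ := h a (Finset.mem_erase.2 ⟨hac, ha⟩)
    rw [Finset.mem_erase] at h1
    exact ⟨h1.2, h1.1, h3.ne', h2, h3⟩
  · intro h a ha
    rw [Finset.mem_erase] at ha
    obtain ⟨h1, h2, _, h3, h4⟩ := h a ha.2 ha.1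
    exact ⟨Finset.mem_erase.2 ⟨h2, h1⟩, h3, h4⟩

theorem FactorCritical.exists_partner (h : FactorCritical G A) {v : V} (hv : v ∈ A) :
    ∃ μ : V → V, ∀ a, a ∈ A → a ≠ v →
      μ a ∈ A ∧ μ a ≠ v ∧ μ a ≠ a ∧ μ (μ a) = a ∧ G.Adj a (μ a) := by
  obtain ⟨μ, hμ⟩ := h.2 v hv
  exact ⟨μ, IsPartner.erase_iff.1 hμ⟩

/-- The vertices `c, x, μ x, z, μ z` form a 5-cycle. As `A` is larger and linked, an edge `g p`
leaves it; going round the cycle to end at `g` and appending `p, μ p` gives a `P₇` closed under `μ`.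
-/
theorem FactorCritical.tileable_of_five_cycle (h : FactorCritical G A) (hcard : 7 ≤ A.card)
    {c : V} (hc : c ∈ A) {μ : V → V} (hμ : IsPartner G (A.erase c) μ) {x z : V}
    (hx : x ∈ A) (hxc : x ≠ c) (hz : z ∈ A) (hzc : z ≠ c) (hzx : z ≠ x) (hzy : z ≠ μ x)
    (h1 : G.Adj c x) (h2 : G.Adj (μ x) z) (h3 : G.Adj (μ z) c) : Tileable G A := by
  have hp := IsPartner.erase_iff.1 hμ
  obtain ⟨x1, x2, x3, x4, x5⟩ := hp x hx hxc
  obtain ⟨z1, z2, z3, z4, z5⟩ := hp z hz hzc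
  obtain ⟨g, hg, p, hpA, hpW, hgp⟩ := h.linked.exists_adj (W := {c, x, μ x, z, μ z})
    (by intro v; simp only [Finset.mem_insert, Finset.mem_singleton]; grind) (by simp)
    (lt_of_le_of_lt Finset.card_le_five (by omega))
  simp only [Finset.mem_insert, Finset.mem_singleton, not_or] at hg hpW
  obtain ⟨p1, p2, p3, p4, p5⟩ := hp p hpA hpW.1
  have s1 := h1.symm
  have s2 := h2.symm
  have s3 := h3.symm
  have s4 := x5.symm
  have s5 := z5.symm
  rcases hg with rfl | rfl | rfl | rfl | rfl
  · exact hμ.tileable_of_seven (l := [x, μ x, z, μ z, g, p, μ p]) rfl (by grind)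
      (by simp only [List.isChain_cons_cons, List.IsChain.singleton]; and_intros <;> trivial)
      (by grind) (by grind) (by grind)
  · exact hμ.tileable_of_seven (l := [μ g, z, μ z, c, g, p, μ p]) rfl (by grind)
      (by simp only [List.isChain_cons_cons, List.IsChain.singleton]; and_intros <;> trivial)
      (by grind) (by grind) (by grind)
  · exact hμ.tileable_of_seven (l := [z, μ z, c, x, μ x, p, μ p]) rfl (by grind)
      (by simp only [List.isChain_cons_cons, List.IsChain.singleton]; and_intros <;> trivial)
      (by grind) (by grind) (by grind)
  · exact hμ.tileable_of_seven (l := [μ g, c, x, μ x, g, p, μ p]) rfl (by grind)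
      (by simp only [List.isChain_cons_cons, List.IsChain.singleton]; and_intros <;> trivial)
      (by grind) (by grind) (by grind)
  · exact hμ.tileable_of_seven (l := [c, x, μ x, z, μ z, p, μ p]) rfl (by grind)
      (by simp only [List.isChain_cons_cons, List.IsChain.singleton]; and_intros <;> trivial)
      (by grind) (by grind) (by grind)

/-- Start along an edge `c x` and alternate between `μ`, missing `c`, and `ν`, missing `x`.
Returning to `c` by the first `ν`-edge gives the triangle, by the second a 5-cycle; otherwise the
walk is a `P₇`. -/
theorem FactorCritical.exists_triangle (h : FactorCritical G A) (hcard : 7 ≤ A.card)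
    (hT : ¬ Tileable G A) {c : V} (hc : c ∈ A) {μ : V → V} (hμ : IsPartner G (A.erase c) μ) :
    ∃ a ∈ A, a ≠ c ∧ G.Adj c a ∧ G.Adj c (μ a) := by
  have hp := IsPartner.erase_iff.1 hμ
  obtain ⟨g, hg, x, hx, hxW, hgx⟩ := h.linked.exists_adj (W := {c}) (by simpa using hc) (by simp)
    (by rw [Finset.card_singleton]; omega)
  rw [Finset.mem_singleton] at hg hxW
  subst hg
  obtain ⟨x1, x2, x3, x4, x5⟩ := hp x hx hxW
  obtain ⟨ν, hν⟩ := h.exists_partner hx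
  obtain ⟨y1, y2, y3, y4, y5⟩ := hν (μ x) x1 x3
  by_cases hz : ν (μ x) = g
  · exact ⟨x, hx, hxW, hgx, hz ▸ y5.symm⟩
  exfalso
  apply hT
  rw [← ne_eq] at hz
  obtain ⟨z, hzdef⟩ : ∃ z, z = ν (μ x) := ⟨_, rfl⟩
  rw [← hzdef] at hz y1 y2 y3 y4 y5
  obtain ⟨z1, z2, z3, z4, z5⟩ := hp z y1 hz
  have hwx : μ z ≠ x := by grind
  obtain ⟨u1, u2, u3, u4, u5⟩ := hν (μ z) z1 hwx
  by_cases hu : ν (μ z) = g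
  · exact h.tileable_of_five_cycle hcard hc hμ hx hxW y1 hz y2 y3 hgx y5 (hu ▸ u5)
  obtain ⟨u, hudef⟩ : ∃ u, u = ν (μ z) := ⟨_, rfl⟩
  rw [← hudef] at hu u1 u2 u3 u4 u5
  obtain ⟨v1, v2, v3, v4, v5⟩ := hp u u1 hu
  have hux : u ≠ x := u2
  have huy : u ≠ μ x := by grind
  have huz : u ≠ z := by grind
  clear hν hp hzdef hudef y4 u4
  exact hμ.tileable_of_seven (l := [g, x, μ x, z, μ z, u, μ u]) rfl (by grind)
      (by simp only [List.isChain_cons_cons, List.IsChain.singleton]; and_intros <;> trivial)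
    (by grind) (by grind) (by grind)

/-- Let `z` be the partner of `μ p` in a matching missing `p`. If `z = c` the claim holds; if `z`
lies on the triangle there is a 5-cycle; otherwise the triangle, the edge `c p` and the edge `z (μ
z)` yield a `P₇`. -/
theorem FactorCritical.adj_partner (h : FactorCritical G A) (hcard : 7 ≤ A.card)
    (hT : ¬ Tileable G A) {c : V} (hc : c ∈ A) {μ : V → V} (hμ : IsPartner G (A.erase c) μ)
    {a p : V} (ha : a ∈ A) (hac : a ≠ c) (h1 : G.Adj c a) (h2 : G.Adj c (μ a)) (hpA : p ∈ A)
    (hpc : p ≠ c) (hcp : G.Adj c p) : G.Adj c (μ p) := by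
  have hp := IsPartner.erase_iff.1 hμ
  by_contra hcon
  apply hT
  obtain ⟨a1, a2, a3, a4, a5⟩ := hp a ha hac
  obtain ⟨p1, p2, p3, p4, p5⟩ := hp p hpA hpc
  have hpa : p ≠ a := by grind
  have hpb : p ≠ μ a := by grind
  obtain ⟨ν, hν⟩ := h.exists_partner hpA
  obtain ⟨z1, z2, z3, z4, z5⟩ := hν (μ p) p1 p3
  generalize ν (μ p) = z at z1 z2 z3 z4 z5
  have hzc : z ≠ c := by
    intro e
    exact hcon (e ▸ z5.symm)
  by_cases hza : z = a
  · exact h.tileable_of_five_cycle hcard hc hμ hpA hpc ha hac hpa.symm (by grind) hcp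
      (hza ▸ z5) h2.symm
  by_cases hzb : z = μ a
  · exact h.tileable_of_five_cycle hcard hc hμ hpA hpc a1 a2 hpb.symm (by grind) hcp
      (hzb ▸ z5) (by rw [a4]; exact h1.symm)
  obtain ⟨w1, w2, w3, w4, w5⟩ := hp z z1 hzc
  have s2 := h2.symm
  clear hν hp z4
  exact hμ.tileable_of_seven (l := [a, μ a, c, p, μ p, z, μ z]) rfl (by grind)
      (by simp only [List.isChain_cons_cons, List.IsChain.singleton]; and_intros <;> trivial)
    (by grind) (by grind) (by grind)

/-- An edge leaves the first triangle. The triangle can be rotated so that this edge starts at its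
unmatched vertex, and `FactorCritical.adj_partner` closes a second triangle there. -/
theorem FactorCritical.exists_two_triangles (h : FactorCritical G A) (hcard : 7 ≤ A.card)
    (hT : ¬ Tileable G A) : ∃ c ∈ A, ∃ μ : V → V, IsPartner G (A.erase c) μ ∧ ∃ a ∈ A, ∃ p ∈ A,
      a ≠ c ∧ p ≠ c ∧ p ≠ a ∧ p ≠ μ a ∧ G.Adj c a ∧ G.Adj c (μ a) ∧ G.Adj c p ∧ G.Adj c (μ p) := by
  obtain ⟨c, hc⟩ := h.1
  obtain ⟨μ, hμ⟩ := h.2 c hc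
  obtain ⟨a, ha, hac, h1, h2⟩ := h.exists_triangle hcard hT hc hμ
  have key : ∀ c ∈ A, ∀ μ : V → V, IsPartner G (A.erase c) μ → ∀ a ∈ A, a ≠ c → G.Adj c a →
      G.Adj c (μ a) → ∀ p ∈ A, p ≠ c → p ≠ a → p ≠ μ a → G.Adj c p →
      ∃ c ∈ A, ∃ μ : V → V, IsPartner G (A.erase c) μ ∧ ∃ a ∈ A, ∃ p ∈ A,
      a ≠ c ∧ p ≠ c ∧ p ≠ a ∧ p ≠ μ a ∧ G.Adj c a ∧ G.Adj c (μ a) ∧ G.Adj c p ∧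
        G.Adj c (μ p) := by
    intro c hc μ hμ a ha hac h1 h2 p hp hpc hpa hpb hcp
    exact ⟨c, hc, μ, hμ, a, ha, p, hp, hac, hpc, hpa, hpb, h1, h2, hcp,
      h.adj_partner hcard hT hc hμ ha hac h1 h2 hp hpc hcp⟩
  have swap : ∀ a, a ∈ A → a ≠ c → G.Adj c a → G.Adj c (μ a) → ∀ p ∈ A, p ≠ c → p ≠ a →
      p ≠ μ a → G.Adj a p → ∃ c ∈ A, ∃ μ : V → V, IsPartner G (A.erase c) μ ∧
      ∃ a ∈ A, ∃ p ∈ A, a ≠ c ∧ p ≠ c ∧ p ≠ a ∧ p ≠ μ a ∧ G.Adj c a ∧ G.Adj c (μ a) ∧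
      G.Adj c p ∧ G.Adj c (μ p) := by
    intro a ha hac h1 h2 p hp hpc hpa hpb hap
    have hq := IsPartner.erase_iff.1 hμ
    obtain ⟨a1, a2, a3, a4, a5⟩ := hq a ha hac
    have s2 := h2.symm
    -- Rotated matching: pairing `c` with `μ a` leaves `a` as the unmatched vertex.
    refine key a ha (fun x => if x = c then μ a else if x = μ a then c else μ x) ?_ c hc
      hac.symm h1.symm (by simpa using a5) p hp hpa hpc (by simpa using hpb) hap
    rw [IsPartner.erase_iff]
    intro x hx hxa
    have := hq x hx
    grind
  obtain ⟨a1, a2, a3, a4, a5⟩ := IsPartner.erase_iff.1 hμ a ha hac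
  obtain ⟨g, hg, p, hpA, hpW, hgp⟩ := h.linked.exists_adj (W := {c, a, μ a})
    (by intro v; simp only [Finset.mem_insert, Finset.mem_singleton]; grind) (by simp)
    (lt_of_le_of_lt Finset.card_le_three (by omega))
  simp only [Finset.mem_insert, Finset.mem_singleton, not_or] at hg hpW
  obtain ⟨q1, q2, q3⟩ := hpW
  rcases hg with rfl | rfl | rfl
  · exact key g hc μ hμ a ha hac h1 h2 p hpA q1 q2 q3 hgp
  · exact swap g ha hac h1 h2 p hpA q1 q2 q3 hgp
  · exact swap (μ a) a1 a2 h2 (by rwa [a4]) p hpA q1 q3 (by rwa [a4]) hgp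

/-- A factor-critical set of order at least seven without a tiling induces a windmill: triangles
sharing one vertex. -/
theorem FactorCritical.windmill (h : FactorCritical G A) (hcard : 7 ≤ A.card)
    (hT : ¬ Tileable G A) : ∃ c ∈ A, ∃ μ : V → V, IsPartner G (A.erase c) μ ∧
      ∀ x ∈ A, x ≠ c → ∀ y ∈ A, y ≠ c → G.Adj x y → y = μ x := by
  obtain ⟨c, hc, μ, hμ, a, ha, p, hp, hac, hpc, hpa, hpb, h1, h2, h3, h4⟩ :=
    h.exists_two_triangles hcard hT
  have hq := IsPartner.erase_iff.1 hμ
  refine ⟨c, hc, μ, hμ, ?_⟩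
  -- Two triangles at `c` and an edge from one of them to a third matching edge form the path `d, μ
  -- d, c, μ g, g, x, μ x`.
  have tri : ∀ d ∈ A, d ≠ c → G.Adj c d → G.Adj c (μ d) → ∀ g ∈ A, g ≠ c → g ≠ d → g ≠ μ d →
      G.Adj c g → G.Adj c (μ g) → ∀ x ∈ A, x ≠ c → x ≠ g → x ≠ μ g → x ≠ d → x ≠ μ d →
      ¬ G.Adj g x := by
    intro d hd hdc d1 d2 g hg hgc hgd hgd' g1 g2 x hx hxc hxg hxg' hxd hxd' hgx
    obtain ⟨e1, e2, e3, e4, e5⟩ := hq d hd hdc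
    obtain ⟨f1, f2, f3, f4, f5⟩ := hq g hg hgc
    obtain ⟨i1, i2, i3, i4, i5⟩ := hq x hx hxc
    have s1 := f5.symm
    have s2 := d2.symm
    exact hT <| hμ.tileable_of_seven (l := [d, μ d, c, μ g, g, x, μ x]) rfl (by grind)
      (by simp only [List.isChain_cons_cons, List.IsChain.singleton]; and_intros <;> trivial)
      (by grind) (by grind) (by grind)
  -- The vertices lying in triangles at `c`, with `c` itself, are closed under adjacency: of the two
  -- known triangles, at least one avoids `g` and can be fed to `tri`.
  have hall : ∀ x ∈ A, x ≠ c → G.Adj c x ∧ G.Adj c (μ x) := by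
    classical
    have hW := h.linked (A.filter fun x => x = c ∨ (G.Adj c x ∧ G.Adj c (μ x)))
      (Finset.filter_subset _ _) ⟨c, by simp [hc]⟩ ?_
    · intro x hx hxc
      rw [← hW] at hx
      exact (Finset.mem_filter.1 hx).2.resolve_left hxc
    intro g hg x hx hgx
    rw [Finset.mem_filter] at hg ⊢
    obtain ⟨hgA, hg⟩ := hg
    refine ⟨hx, ?_⟩
    by_contra! hcon
    obtain ⟨hxc, hcon⟩ := hcon
    by_cases hgc : g = c
    · subst hgc
      exact hcon hgx (h.adj_partner hcard hT hc hμ ha hac h1 h2 hx hxc hgx)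
    obtain ⟨g1, g2⟩ := hg.resolve_left hgc
    obtain ⟨e1, e2, e3, e4, e5⟩ := hq g hgA hgc
    obtain ⟨a1, a2, a3, a4, a5⟩ := hq a ha hac
    obtain ⟨p1, p2, p3, p4, p5⟩ := hq p hp hpc
    by_cases hga : g ≠ a ∧ g ≠ μ a
    · exact tri a ha hac h1 h2 g hgA hgc hga.1 hga.2 g1 g2 x hx hxc (by grind) (by grind)
        (by grind) (by grind) hgx
    · exact tri p hp hpc h3 h4 g hgA hgc (by grind) (by grind) g1 g2 x hx hxc (by grind) (by grind)
        (by grind) (by grind) hgx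
  intro x hx hxc y hy hyc hxy
  by_contra hne
  -- Order at least seven provides a third triangle, so `tri` rules out an edge between two blades.
  obtain ⟨d, hd, hd'⟩ : ∃ d ∈ A, d ∉ ({c, x, μ x, y, μ y} : Finset V) := by
    by_contra! hcon
    have := (Finset.card_le_card hcon).trans Finset.card_le_five
    omega
  simp only [Finset.mem_insert, Finset.mem_singleton, not_or] at hd'
  obtain ⟨d1, d2, d3, d4, d5⟩ := hd'
  obtain ⟨x1, x2, x3, x4, x5⟩ := hq x hx hxc
  obtain ⟨y1, y2, y3, y4, y5⟩ := hq y hy hyc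
  obtain ⟨e1, e2, e3, e4, e5⟩ := hq d hd d1
  exact tri d hd d1 (hall d hd d1).1 (hall d hd d1).2 x hx hxc (by grind) (by grind)
    (hall x hx hxc).1 (hall x hx hxc).2 y hy hyc hxy.ne' hne (by grind) (by grind) hxy

/-- The weight of a component: three for isolated vertices and one for orders three and five. -/
def weight (T : Finset V) : ℕ :=
  if T.card = 1 then 3 else if T.card = 3 ∨ T.card = 5 then 1 else 0

/-- A factor-critical set without a tiling has a deletion set all of whose remaining small
components together outweigh it. -/
theorem FactorCritical.exists_heavy (h : FactorCritical G A) (hT : ¬ Tileable G A) :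
    ∃ U ⊆ A, ∃ I : Finset (Finset V), (∀ T ∈ I, T ⊆ A ∧ T.Nonempty ∧ Disjoint T U ∧
      (∀ a ∈ T, ∀ b ∈ A, G.Adj a b → b ∈ T ∨ b ∈ U) ∧ Linked G T) ∧ 
      (I : Set (Finset V)).PairwiseDisjoint id ∧
      (if A.card = 1 then 2 else 1) + 2 * U.card ≤ ∑ T ∈ I, weight T := by
  have hodd := h.odd_card
  -- For orders 1, 3 and 5 delete nothing and take `A` itself: its weight 3, 1, 1 covers the demand
  -- 2, 1, 1.
  by_cases hcard : A.card < 7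
  · refine ⟨∅, by simp, {A}, ?_, by simp, ?_⟩
    · intro T hTA
      rw [Finset.mem_singleton] at hTA
      subst hTA
      exact ⟨subset_rfl, h.1, by simp, fun a _ b hb _ => Or.inl hb, h.linked⟩
    · rw [Finset.sum_singleton, weight]
      have : A.card = 1 ∨ A.card = 3 ∨ A.card = 5 := by
        obtain ⟨k, hk⟩ := hodd
        omega
      rcases this with e | e | e <;> simp [e]
  rw [not_lt] at hcard
  obtain ⟨c, hc, μ, hμ, hadj⟩ := h.windmill hcard hT
  have hq := IsPartner.erase_iff.1 hμ
  have pick : ∀ B : Finset V, B.card ≤ 5 → ∃ d ∈ A, d ∉ B := by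
    intro B hB
    by_contra! hcon
    have := Finset.card_le_card hcon
    omega
  obtain ⟨x, hx, hx'⟩ := pick {c} (by simp)
  obtain ⟨y, hy, hy'⟩ := pick {c, x, μ x} (Finset.card_le_three.trans (by omega))
  obtain ⟨z, hz, hz'⟩ := pick {c, x, μ x, y, μ y} Finset.card_le_five
  simp only [Finset.mem_insert, Finset.mem_singleton, not_or] at hx' hy' hz'
  have qx := hq x hx hx'
  have qy := hq y hy hy'.1
  have qz := hq z hz hz'.1
  have hxy : μ x ≠ μ y := by grind
  have hxz : μ x ≠ μ z := by grind
  have hyz : μ y ≠ μ z := by grind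
  -- Deleting the centre and one end of each of three blades isolates the other ends: weight `9 = 1
  -- + 2 * 4`.
  refine ⟨{c, x, y, z}, ?_, {{μ x}, {μ y}, {μ z}}, ?_, ?_, ?_⟩
  · intro v
    simp only [Finset.mem_insert, Finset.mem_singleton]
    grind
  · intro T hTI
    obtain ⟨v, rfl, hv⟩ : ∃ v, T = {v} ∧ (v = μ x ∨ v = μ y ∨ v = μ z) := by
      simp only [Finset.mem_insert, Finset.mem_singleton] at hTI
      rcases hTI with rfl | rfl | rfl
      exacts [⟨_, rfl, by simp⟩, ⟨_, rfl, by simp⟩, ⟨_, rfl, by simp⟩]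
    refine ⟨?_, by simp, ?_, ?_, linked_singleton v⟩
    · rw [Finset.singleton_subset_iff]; grind
    · rw [Finset.disjoint_singleton_left]
      simp only [Finset.mem_insert, Finset.mem_singleton]
      grind
    · intro a ha b hb hab
      rw [Finset.mem_singleton] at ha
      subst ha
      simp only [Finset.mem_insert, Finset.mem_singleton]
      have := hadj a (by grind) (by grind) b hb
      grind
  · intro S hS T hT' hne
    simp only [Finset.coe_insert, Finset.coe_singleton, Set.mem_insert_iff,
      Set.mem_singleton_iff] at hS hT'
    rw [Function.onFun, id, id]
    rcases hS with rfl | rfl | rfl <;> rcases hT' with rfl | rfl | rfl <;>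
      first | exact absurd rfl hne | (rw [Finset.disjoint_singleton]; grind)
  · have hU : ({c, x, y, z} : Finset V).card ≤ 4 := Finset.card_le_four
    rw [Finset.sum_insert (by simp [hxy, hxz]), Finset.sum_insert (by simp [hyz]),
      Finset.sum_singleton, if_neg (by omega)]
    simp only [weight, Finset.card_singleton, if_true]
    omega

end FactorCritical

/-! ### Tutte barriers and the Gallai–Edmonds decomposition -/

/-- `𝒯` is a family of disjoint odd subsets of `B \ S`, each a union of components of the graph
induced on `B \ S`. -/
def OddParts (G : SimpleGraph V) (B S : Finset V) (𝒯 : Finset (Finset V)) : Prop :=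
  (∀ T ∈ 𝒯, T ⊆ B ∧ Odd T.card ∧ Disjoint T S ∧ ∀ a ∈ T, ∀ b ∈ B, G.Adj a b → b ∈ T ∨ b ∈ S) ∧
    (𝒯 : Set (Finset V)).PairwiseDisjoint id

theorem exists_finset_oddComponents [DecidableEq V] {W : Type*} [Finite W] (K : SimpleGraph W)
    (e : W ↪ V) : ∃ 𝒪 : Finset (Finset V), 𝒪.card = K.oddComponents.ncard ∧
      (𝒪 : Set (Finset V)).PairwiseDisjoint id ∧ ∀ T ∈ 𝒪, Odd T.card ∧
        (∀ v ∈ T, ∃ w, e w = v) ∧ ∀ w w', K.Adj w w' → e w ∈ T → e w' ∈ T := by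
  classical
  have := Fintype.ofFinite W
  let t : K.ConnectedComponent → Finset V := fun C => C.supp.toFinset.map e
  have ht : ∀ C w, e w ∈ t C ↔ K.connectedComponentMk w = C := by
    intro C w
    simp [t]
  have hinj : Injective t := by
    intro C D hCD
    obtain ⟨w, rfl⟩ := C.exists_rep
    exact (ht D w).1 (hCD ▸ (ht _ w).2 rfl)
  have hmem : ∀ C, ∀ v ∈ t C, ∃ w, e w = v := by
    intro C v hv
    obtain ⟨w, _, rfl⟩ := Finset.mem_map.1 hv
    exact ⟨w, rfl⟩
  refine ⟨K.oddComponents.toFinset.map ⟨t, hinj⟩, ?_, ?_, ?_⟩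
  · rw [Finset.card_map, Set.ncard_eq_toFinset_card']
  · intro T hT T' hT' hne
    rw [Finset.mem_coe, Finset.mem_map] at hT hT'
    obtain ⟨C, -, rfl⟩ := hT
    obtain ⟨D, -, rfl⟩ := hT'
    change Disjoint (t C) (t D)
    rw [Finset.disjoint_left]
    intro v hv hv'
    obtain ⟨w, rfl⟩ := hmem C v hv
    rw [ht] at hv hv'
    exact hne (by rw [← hv, ← hv'])
  · intro T hT
    rw [Finset.mem_map] at hT
    obtain ⟨C, hC, rfl⟩ := hT
    refine ⟨?_, hmem C, ?_⟩
    · change Odd (t C).card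
      rw [Finset.card_map, ← Set.ncard_eq_toFinset_card']
      simpa using hC
    · intro w w' hww' hw
      change e w' ∈ t C
      have hw : e w ∈ t C := hw
      rw [ht] at hw ⊢
      rw [← hw]
      exact SimpleGraph.ConnectedComponent.sound hww'.symm.reachable

section Barrier

variable [DecidableEq V] {G : SimpleGraph V}

/-- Tutte's theorem for the graph induced on an even set of vertices. -/
theorem exists_oddParts_of_not_matched {B : Finset V} (hB : ¬ Matched G B) (heven : Even B.card) :
    ∃ U ⊆ B, ∃ 𝒪, OddParts G B U 𝒪 ∧ U.card + 2 ≤ 𝒪.card := by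
  classical
  let H : SimpleGraph B := G.comap (Subtype.val : B → V)
  have hcard : Nat.card B = B.card := by simp
  have hM : ∀ M : H.Subgraph, ¬ M.IsPerfectMatching := by
    intro M hM
    rw [SimpleGraph.Subgraph.isPerfectMatching_iff] at hM
    choose f hf huniq using hM
    refine hB ⟨fun v => if h : v ∈ B then f ⟨v, h⟩ else v, fun a ha => ?_⟩
    have h1 := hf ⟨a, ha⟩
    have h2 : f (f ⟨a, ha⟩) = ⟨a, ha⟩ := (huniq _ _ h1.symm).symm
    have h3 : G.Adj a (f ⟨a, ha⟩) := h1.adj_sub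
    simp [ha, h2, h3]
  obtain ⟨u, hu⟩ := SimpleGraph.exists_isTutteViolator hM (by rwa [hcard])
  rw [SimpleGraph.IsTutteViolator] at hu
  let K := ((⊤ : H.Subgraph).deleteVerts u).coe
  have hKv : ∀ w : B, w ∈ ((⊤ : H.Subgraph).deleteVerts u).verts ↔ w ∉ u := by
    intro w
    simp
  have hodd := K.odd_ncard_oddComponents
  have hcK : Nat.card ((⊤ : H.Subgraph).deleteVerts u).verts = B.card - u.ncard := by
    have : ((⊤ : H.Subgraph).deleteVerts u).verts = uᶜ := by
      ext w
      rw [hKv, Set.mem_compl_iff]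
    rw [Nat.card_coe_set_eq, this, Set.ncard_compl, hcard]
  rw [hcK] at hodd
  have hule : u.ncard ≤ B.card := hcard ▸ Set.ncard_le_card u
  let e : ((⊤ : H.Subgraph).deleteVerts u).verts ↪ V :=
    (Function.Embedding.subtype _).trans (Function.Embedding.subtype _)
  obtain ⟨𝒪, hc, hd, h𝒪⟩ := exists_finset_oddComponents K e
  let U : Finset V := u.toFinset.map (Function.Embedding.subtype _)
  have hU : ∀ w : B, (w : V) ∈ U ↔ w ∈ u := by
    intro w
    simp [U]
  have hUc : U.card = u.ncard := by
    rw [Finset.card_map, Set.ncard_eq_toFinset_card']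
  refine ⟨U, ?_, 𝒪, ⟨?_, hd⟩, ?_⟩
  · intro v hv
    obtain ⟨w, _, rfl⟩ := Finset.mem_map.1 hv
    exact w.2
  · intro T hT
    obtain ⟨h1, h2, h3⟩ := h𝒪 T hT
    refine ⟨?_, h1, ?_, ?_⟩
    · intro v hv
      obtain ⟨w, rfl⟩ := h2 v hv
      exact w.1.2
    · rw [Finset.disjoint_left]
      intro v hv hvU
      obtain ⟨w, rfl⟩ := h2 v hv
      exact (hKv _).1 w.2 ((hU w.1).1 hvU)
    · intro a ha b hb hab
      obtain ⟨w, rfl⟩ := h2 a ha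
      by_cases hbu : (⟨b, hb⟩ : B) ∈ u
      · exact Or.inr ((hU _).2 hbu)
      · left
        refine h3 w ⟨⟨b, hb⟩, (hKv _).2 hbu⟩ ?_ ha
        have := (hKv _).1 w.2
        have hab' : H.Adj w.1 ⟨b, hb⟩ := hab
        simp [K, this, hbu, hab']
  · rw [hUc, hc]
    change _ < K.oddComponents.ncard at hu
    -- As `B` is even, the number of odd components has the parity of `|U|`, so an excess of one is
    -- impossible.
    by_contra hlt
    have heq : K.oddComponents.ncard = u.ncard + 1 := by omega
    rw [heq] at hodd
    rw [Nat.odd_add_one, Nat.not_odd_iff_even, Nat.odd_sub hule] at hodd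
    grind

/-- Purpose: a barrier found inside an unused region `D` can be added to the global one, and the
numbers of parts add up. -/
theorem OddParts.union {B D S U : Finset V} {𝒯 𝒪 : Finset (Finset V)} (h : OddParts G B S 𝒯)
    (hD : D ⊆ B) (hDS : Disjoint D S) (hDT : ∀ T ∈ 𝒯, Disjoint D T)
    (hcl : ∀ a ∈ D, ∀ b ∈ B, G.Adj a b → b ∈ D ∨ b ∈ S) (h' : OddParts G D U 𝒪) (hU : U ⊆ D) :
    OddParts G B (S ∪ U) (𝒯 ∪ 𝒪) ∧ (𝒯 ∪ 𝒪).card = 𝒯.card + 𝒪.card := by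
  refine ⟨⟨?_, ?_⟩, ?_⟩
  · intro T hT
    rcases Finset.mem_union.1 hT with hT | hT
    · obtain ⟨h1, h2, h3, h4⟩ := h.1 T hT
      refine ⟨h1, h2, ?_, fun a ha b hb hab => ?_⟩
      · exact Finset.disjoint_union_right.2 ⟨h3, ((hDT T hT).mono_left hU).symm⟩
      · rcases h4 a ha b hb hab with h | h
        · exact Or.inl h
        · exact Or.inr (Finset.mem_union_left _ h)
    · obtain ⟨h1, h2, h3, h4⟩ := h'.1 T hT
      refine ⟨h1.trans hD, h2, ?_, fun a ha b hb hab => ?_⟩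
      · exact Finset.disjoint_union_right.2 ⟨hDS.mono_left h1, h3⟩
      · rcases hcl a (h1 ha) b hb hab with h | h
        · rcases h4 a ha b h hab with h | h
          · exact Or.inl h
          · exact Or.inr (Finset.mem_union_right _ h)
        · exact Or.inr (Finset.mem_union_left _ h)
  · rw [Finset.coe_union, Set.pairwiseDisjoint_union]
    exact ⟨h.2, h'.2, fun T hT T' hT' _ => ((hDT T hT).mono_left (h'.1 T' hT').1).symm⟩
  · refine Finset.card_union_of_disjoint (Finset.disjoint_left.2 fun T hT hT' => ?_)
    obtain ⟨h1, h2, -⟩ := h'.1 T hT'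
    have := (hDT T hT).mono_left h1
    rw [disjoint_self, Finset.bot_eq_empty] at this
    subst this
    simp at h2

/-- The part of the Gallai–Edmonds structure theorem that a maximal barrier provides. -/
theorem exists_decomposition [Fintype V] (G : SimpleGraph V) :
    ∃ (S : Finset V) (𝒯 : Finset (Finset V)), OddParts G univ S 𝒯 ∧
      (∀ T ∈ 𝒯, FactorCritical G T) ∧ Matched G (univ \ (S ∪ 𝒯.biUnion id)) ∧
      ∀ A ⊆ S, ∃ N ⊆ 𝒯, A.card ≤ N.card ∧ ∀ T ∈ N, ∃ a ∈ A, ∃ t ∈ T, G.Adj a t := by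
  classical
  -- The lexicographic order maximizes the excess first and `|S|` second; the tie-break is what
  -- forces the parts to be factor-critical.
  obtain ⟨⟨S, 𝒯⟩, hmem, hmax⟩ := Finset.exists_max_image
    ((univ : Finset (Finset V × Finset (Finset V))).filter fun p => OddParts G univ p.1 p.2)
    (fun p => toLex ((p.2.card : ℤ) - p.1.card, p.1.card))
    ⟨(∅, ∅), by simp [OddParts]⟩
  have hST : OddParts G univ S 𝒯 := (Finset.mem_filter.1 hmem).2
  have hopt : ∀ S' 𝒯', OddParts G univ S' 𝒯' →
      (𝒯'.card : ℤ) - S'.card < 𝒯.card - S.card ∨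
        ((𝒯'.card : ℤ) - S'.card = 𝒯.card - S.card ∧ S'.card ≤ S.card) := by
    intro S' 𝒯' h
    have := hmax (S', 𝒯') (by simp [h])
    rwa [Prod.Lex.toLex_le_toLex] at this
  refine ⟨S, 𝒯, hST, ?_, ?_, ?_⟩
  · intro C hC
    obtain ⟨-, hodd, hdis, hcl⟩ := hST.1 C hC
    refine ⟨Finset.card_pos.1 hodd.pos, fun v hv => ?_⟩
    by_contra hM
    have hvS : v ∉ S := Finset.disjoint_left.1 hdis hv
    -- Moving `v` and `U` into the barrier costs the part `C` and `1 + |U|` barrier vertices but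
    -- gains at least `|U| + 2` parts: the excess does not drop while `S` grows.
    obtain ⟨U, hU, 𝒪, h𝒪, hlt⟩ := exists_oddParts_of_not_matched hM (by
      rw [Finset.card_erase_of_mem hv]
      exact hodd.tsub_odd odd_one)
    have hbase : OddParts G univ (insert v S) (𝒯.erase C) := by
      refine ⟨fun T hT => ?_, hST.2.subset (by simp)⟩
      obtain ⟨hne, hT⟩ := Finset.mem_erase.1 hT
      obtain ⟨h1, h2, h3, h4⟩ := hST.1 T hT
      refine ⟨h1, h2, ?_, fun a ha b hb hab => ?_⟩
      · rw [Finset.disjoint_insert_right]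
        exact ⟨fun hvT => Finset.disjoint_left.1 (hST.2 hT hC hne) hvT hv, h3⟩
      · exact (h4 a ha b hb hab).imp_right (Finset.mem_insert_of_mem)
    obtain ⟨hnew, hcard⟩ := hbase.union (D := C.erase v) (Finset.subset_univ _)
      (by
        rw [Finset.disjoint_insert_right]
        exact ⟨Finset.notMem_erase v C, hdis.mono_left (Finset.erase_subset _ _)⟩)
      (fun T hT => (hST.2 hC (Finset.mem_of_mem_erase hT)
        (Finset.ne_of_mem_erase hT).symm).mono_left (Finset.erase_subset _ _))
      (fun a ha b hb hab => by
        rcases hcl a (Finset.mem_of_mem_erase ha) b hb hab with h | h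
        · by_cases hbv : b = v
          · exact Or.inr (by simp [hbv])
          · exact Or.inl (Finset.mem_erase.2 ⟨hbv, h⟩)
        · exact Or.inr (Finset.mem_insert_of_mem h)) h𝒪 hU
    have hSU : (insert v S ∪ U).card = S.card + 1 + U.card := by
      rw [Finset.card_union_of_disjoint, Finset.card_insert_of_notMem hvS]
      rw [Finset.disjoint_insert_left]
      exact ⟨fun h => Finset.notMem_erase v C (hU h),
        (hdis.mono_left (hU.trans (Finset.erase_subset _ _))).symm⟩
    have h1 := Finset.card_erase_of_mem hC
    have h2 := Finset.card_pos.2 ⟨C, hC⟩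
    have := hopt _ _ hnew
    omega
  · set R := univ \ (S ∪ 𝒯.biUnion id) with hR
    have hRS : Disjoint R S :=
      Finset.disjoint_left.2 fun v hv hvS => by simp [hR, hvS] at hv
    have hRT : ∀ T ∈ 𝒯, Disjoint R T := fun T hT =>
      Finset.disjoint_left.2 fun v hv hvT => by
        rw [hR, Finset.mem_sdiff, Finset.mem_union, not_or] at hv
        exact hv.2.2 (Finset.mem_biUnion.2 ⟨T, hT, hvT⟩)
    have hcl : ∀ a ∈ R, ∀ b ∈ (univ : Finset V), G.Adj a b → b ∈ R ∨ b ∈ S := by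
      intro a ha b _ hab
      by_contra! hcon
      have : b ∈ 𝒯.biUnion id := by
        by_contra hb
        exact hcon.1 (by simpa [hR, hcon.2] using hb)
      obtain ⟨T, hT, hbT⟩ := Finset.mem_biUnion.1 this
      rcases (hST.1 T hT).2.2.2 b hbT a (Finset.mem_univ a) hab.symm with h | h
      · exact Finset.disjoint_left.1 (hRT T hT) ha h
      · exact Finset.disjoint_left.1 hRS ha h
    by_contra hM
    rcases Nat.even_or_odd R.card with heven | hodd
    · obtain ⟨U, hU, 𝒪, h𝒪, hlt⟩ := exists_oddParts_of_not_matched hM heven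
      obtain ⟨hnew, hcard⟩ := hST.union (Finset.subset_univ R) hRS hRT hcl h𝒪 hU
      have := Finset.card_union_le S U
      have := hopt _ _ hnew
      omega
    -- An odd remainder is itself a further part, raising the excess by one.
    · have hone : OddParts G R ∅ {R} := by
        refine ⟨fun T hT => ?_, by simp⟩
        rw [Finset.mem_singleton] at hT
        subst hT
        exact ⟨subset_rfl, hodd, by simp, fun a _ b hb _ => Or.inl hb⟩
      obtain ⟨hnew, hcard⟩ := hST.union (Finset.subset_univ R) hRS hRT hcl hone (by simp)
      have := hopt _ _ hnew
      rw [hcard, Finset.union_empty, Finset.card_singleton] at this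
      omega
  · intro A hA
    refine ⟨𝒯.filter fun T => ∃ a ∈ A, ∃ t ∈ T, G.Adj a t, Finset.filter_subset _ _, ?_,
      fun T hT => (Finset.mem_filter.1 hT).2⟩
    by_contra! hlt
    -- If Hall's condition failed at `A`, dropping `A` from the barrier and the fewer parts adjacent
    -- to it would raise the excess.
    have hnew : OddParts G univ (S \ A) (𝒯.filter fun T => ¬ ∃ a ∈ A, ∃ t ∈ T, G.Adj a t) := by
      refine ⟨fun T hT => ?_, hST.2.subset (Finset.coe_subset.2 (Finset.filter_subset _ _))⟩
      obtain ⟨hT, hTA⟩ := Finset.mem_filter.1 hT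
      obtain ⟨h1, h2, h3, h4⟩ := hST.1 T hT
      refine ⟨h1, h2, h3.mono_right Finset.sdiff_subset, fun a ha b hb hab => ?_⟩
      refine (h4 a ha b hb hab).imp_right fun h => Finset.mem_sdiff.2 ⟨h, fun hbA => hTA ?_⟩
      exact ⟨b, hbA, a, ha, hab.symm⟩
    have h1 := Finset.card_filter_add_card_filter_not (s := 𝒯)
      (fun T => ∃ a ∈ A, ∃ t ∈ T, G.Adj a t)
    have h2 := Finset.card_sdiff_add_card_eq_card hA
    have := hopt _ _ hnew
    omega

end Barrier

/-! ### Bipartite matchings with demands -/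

/-- The Mendelsohn–Dulmage theorem, for a matching `f` saturating the left side and a partial
matching `g` from the set `T` on the right side into the left side. -/
theorem exists_injective_extending {α β : Type*} {R : α → β → Prop} {f : α → β} {g : β → α}
    {T : Set β} (hf : Injective f) (hfR : ∀ a, R a (f a)) (hg : Set.InjOn g T)
    (hgR : ∀ b ∈ T, R (g b) b) :
    ∃ m : α → β, Injective m ∧ (∀ a, R a (m a)) ∧ T ⊆ Set.range m := by
  classical
  -- `Z` consists of the left vertices reached by alternating paths from vertices of `T` missed by
  -- `f`. The new matching reverses `g` on `Z` and follows `f` elsewhere.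
  let Z : Set α := ⋂₀ {Z | (∀ b ∈ T, b ∉ Set.range f → g b ∈ Z) ∧
    ∀ a ∈ Z, f a ∈ T → g (f a) ∈ Z}
  have hZ1 : ∀ b ∈ T, b ∉ Set.range f → g b ∈ Z := fun b hb hbf Y hY => hY.1 b hb hbf
  have hZ2 : ∀ a ∈ Z, f a ∈ T → g (f a) ∈ Z := fun a ha hfa Y hY => hY.2 a (ha Y hY) hfa
  -- The last clause gives injectivity: the new partner of a vertex of `Z` is never the `f`-image of
  -- a vertex outside `Z`.
  have hZ3 : ∀ a ∈ Z, ∃ b ∈ T, g b = a ∧ ∀ a', f a' = b → a' ∈ Z := by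
    let Y : Set α := {a | a ∈ Z ∧ ∃ b ∈ T, g b = a ∧ ∀ a', f a' = b → a' ∈ Z}
    have : Z ⊆ Y := by
      refine Set.sInter_subset_of_mem ⟨fun b hb hbf => ?_, fun a ha hfa => ?_⟩
      · exact ⟨hZ1 b hb hbf, b, hb, rfl, fun a' ha' => absurd ⟨a', ha'⟩ hbf⟩
      · refine ⟨hZ2 a ha.1 hfa, f a, hfa, rfl, fun a' ha' => ?_⟩
        rw [hf ha']
        exact ha.1
    exact fun a ha => (this ha).2
  have hZ4 : ∀ a, ∃ b, a ∈ Z → b ∈ T ∧ g b = a ∧ ∀ a', f a' = b → a' ∈ Z := by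
    intro a
    by_cases ha : a ∈ Z
    · obtain ⟨b, hb⟩ := hZ3 a ha
      exact ⟨b, fun _ => hb⟩
    · exact ⟨f a, fun h => absurd h ha⟩
  choose k hk using hZ4
  have hkT := fun a ha => (hk a ha).1
  have hkg := fun a ha => (hk a ha).2.1
  have hkZ := fun a ha => (hk a ha).2.2
  refine ⟨fun a => if a ∈ Z then k a else f a, ?_, ?_, ?_⟩
  · intro a a' h
    by_cases ha : a ∈ Z <;> by_cases ha' : a' ∈ Z <;> simp only [ha, ha', if_true, if_false] at h
    · rw [← hkg a ha, h, hkg a' ha']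
    · exact absurd (hkZ a ha a' h.symm) ha'
    · exact absurd (hkZ a' ha' a h) ha
    · exact hf h
  · intro a
    by_cases ha : a ∈ Z
    · simp only [ha, if_true]
      have := hgR _ (hkT a ha)
      rwa [hkg a ha] at this
    · simpa only [ha, if_false] using hfR a
  · intro b hb
    by_cases hgb : g b ∈ Z
    · refine ⟨g b, ?_⟩
      simp only [hgb, if_true]
      exact hg (hkT _ hgb) hb (hkg _ hgb)
    · have : b ∈ Set.range f := by
        by_contra hbf
        exact hgb (hZ1 b hb hbf)
      obtain ⟨a, rfl⟩ := this
      refine ⟨a, ?_⟩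
      have ha : a ∉ Z := fun ha => hgb (hZ2 a ha hb)
      simp only [ha, if_false]

/-- A bipartite graph in which `α` satisfies Hall's condition, while vertices in `B₁` have demand
two, vertices in `B₂` have demand one, and each vertex of `α` has capacity two, has a matching `m`
saturating `α` together with a matching `n` of `B₁` and of the vertices of `B₂` that `m` misses. -/
theorem exists_two_matchings {α β : Type*} [Fintype α] [Nonempty α]
    {R : α → β → Prop} (hall : ∀ A : Finset α, ∃ N : Finset β, A.card ≤ N.card ∧
      ∀ b ∈ N, ∃ a ∈ A, R a b)
    [DecidableEq β] {B₁ B₂ : Finset β}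
    (hdem : ∀ A₁ ⊆ B₁, ∀ A₂ ⊆ B₂, ∃ N : Finset α, 2 * A₁.card + A₂.card ≤ 2 * N.card ∧
      ∀ a ∈ N, ∃ b ∈ A₁ ∪ A₂, R a b) :
    ∃ (m : α → β) (n : β → α), Injective m ∧ (∀ a, R a (m a)) ∧ (∀ b ∈ B₁, b ∈ Set.range m) ∧
      (∀ b, b ∈ B₁ ∨ b ∈ B₂ ∧ b ∉ Set.range m → R (n b) b) ∧
      Set.InjOn n {b | b ∈ B₁ ∨ b ∈ B₂ ∧ b ∉ Set.range m} := by
  classical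
  obtain ⟨f, hf, hfR⟩ : ∃ f : α → β, Injective f ∧ ∀ a, R a (f a) := by
    choose N hN hNR using hall
    -- Only the finitely many right vertices occurring in the Hall witnesses matter.
    let β' := (univ : Finset (Finset α)).biUnion N
    have := (Fintype.all_card_le_filter_rel_iff_exists_injective
      (fun (a : α) (b : β') => R a b)).1 ?_
    · obtain ⟨f, hf, hfR⟩ := this
      exact ⟨fun a => f a, fun a a' h => hf (Subtype.ext h), hfR⟩
    · intro A
      refine (hN A).trans ?_
      rw [← Finset.card_map (Embedding.subtype _)]
      refine Finset.card_le_card fun b hb => ?_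
      have hb' : b ∈ β' := Finset.mem_biUnion.2 ⟨A, Finset.mem_univ _, hb⟩
      refine Finset.mem_map.2 ⟨⟨b, hb'⟩, ?_, rfl⟩
      simpa using hNR A b hb
  -- Capacity two becomes two copies of `α`. Each vertex of `B₁` is doubled, one copy tied to each
  -- copy of `α`; a vertex of `B₂` occurs once and may use either.
  obtain ⟨h, hh, hhR⟩ := (Fintype.all_card_le_filter_rel_iff_exists_injective
    (α := (B₁ ⊕ B₁) ⊕ B₂) (β := α ⊕ α) (fun x y => match x, y with
      | Sum.inl (Sum.inl b), Sum.inl a => R a b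
      | Sum.inl (Sum.inr b), Sum.inr a => R a b
      | Sum.inr b, Sum.inl a => R a b
      | Sum.inr b, Sum.inr a => R a b
      | _, _ => False)).1 (by
    intro A
    let X := (univ.filter fun b : B₁ => Sum.inl (Sum.inl b) ∈ A)
    let Y := (univ.filter fun b : B₁ => Sum.inl (Sum.inr b) ∈ A)
    let Z := (univ.filter fun b : B₂ => Sum.inr b ∈ A)
    have hA : A.card ≤ X.card + Y.card + Z.card := by
      have : A ⊆ (X.disjSum Y).disjSum Z := by
        rintro ((b | b) | b) hb <;> simpa [X, Y, Z] using hb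
      simpa using Finset.card_le_card this
    have hsub₁ : ∀ W : Finset B₁, W.map (Embedding.subtype _) ⊆ B₁ := fun W b hb => by
      obtain ⟨b, _, rfl⟩ := Finset.mem_map.1 hb
      exact b.2
    have hsub₂ : Z.map (Embedding.subtype _) ⊆ B₂ := fun b hb => by
      obtain ⟨b, _, rfl⟩ := Finset.mem_map.1 hb
      exact b.2
    -- Applying the demand bound to `X, Z` and to `Y, Z` and adding gives `|X| + |Y| + |Z| ≤ |N| +
    -- |N'|`.
    obtain ⟨N, hN, hNR⟩ := hdem _ (hsub₁ X) _ hsub₂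
    obtain ⟨N', hN', hNR'⟩ := hdem _ (hsub₁ Y) _ hsub₂
    simp only [Finset.card_map] at hN hN'
    refine (hA.trans ?_).trans (Finset.card_le_card (s := N.disjSum N') ?_)
    · rw [Finset.card_disjSum]
      omega
    · rintro (a | a) ha
      · obtain ⟨b, hb, hab⟩ := hNR a (by simpa using ha)
        rw [Finset.mem_filter]
        refine ⟨Finset.mem_univ _, ?_⟩
        rcases Finset.mem_union.1 hb with hb | hb
        · obtain ⟨b, hb', rfl⟩ := Finset.mem_map.1 hb
          exact ⟨Sum.inl (Sum.inl b), (Finset.mem_filter.1 hb').2, hab⟩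
        · obtain ⟨b, hb', rfl⟩ := Finset.mem_map.1 hb
          exact ⟨Sum.inr b, (Finset.mem_filter.1 hb').2, hab⟩
      · obtain ⟨b, hb, hab⟩ := hNR' a (by simpa using ha)
        rw [Finset.mem_filter]
        refine ⟨Finset.mem_univ _, ?_⟩
        rcases Finset.mem_union.1 hb with hb | hb
        · obtain ⟨b, hb', rfl⟩ := Finset.mem_map.1 hb
          exact ⟨Sum.inl (Sum.inr b), (Finset.mem_filter.1 hb').2, hab⟩
        · obtain ⟨b, hb', rfl⟩ := Finset.mem_map.1 hb
          exact ⟨Sum.inr b, (Finset.mem_filter.1 hb').2, hab⟩)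
  have hl : ∀ b (hb : b ∈ B₁), ∃ a, h (Sum.inl (Sum.inl ⟨b, hb⟩)) = Sum.inl a ∧ R a b := by
    intro b hb
    have := hhR (Sum.inl (Sum.inl ⟨b, hb⟩))
    rcases e : h (Sum.inl (Sum.inl ⟨b, hb⟩)) with a | a <;> rw [e] at this
    · exact ⟨a, rfl, this⟩
    · exact this.elim
  have hr : ∀ b (hb : b ∈ B₁), ∃ a, h (Sum.inl (Sum.inr ⟨b, hb⟩)) = Sum.inr a ∧ R a b := by
    intro b hb
    have := hhR (Sum.inl (Sum.inr ⟨b, hb⟩))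
    rcases e : h (Sum.inl (Sum.inr ⟨b, hb⟩)) with a | a <;> rw [e] at this
    · exact this.elim
    · exact ⟨a, rfl, this⟩
  have hs : ∀ b (hb : b ∈ B₂), (∃ a, h (Sum.inr ⟨b, hb⟩) = Sum.inl a ∧ R a b) ∨
      ∃ a, h (Sum.inr ⟨b, hb⟩) = Sum.inr a ∧ R a b := by
    intro b hb
    have := hhR (Sum.inr ⟨b, hb⟩)
    rcases e : h (Sum.inr ⟨b, hb⟩) with a | a <;> rw [e] at this
    · exact Or.inl ⟨a, rfl, this⟩
    · exact Or.inr ⟨a, rfl, this⟩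
  let P : Bool → β → α → Prop := fun i b a =>
    (∃ hb : b ∈ B₁, h (Sum.inl (if i then Sum.inl ⟨b, hb⟩ else Sum.inr ⟨b, hb⟩)) =
      if i then Sum.inl a else Sum.inr a) ∨
    ∃ hb : b ∈ B₂, h (Sum.inr ⟨b, hb⟩) = if i then Sum.inl a else Sum.inr a
  have hPinj : ∀ i b b' a, P i b a → P i b' a → b = b' := by
    rintro i b b' a (⟨hb, e⟩ | ⟨hb, e⟩) (⟨hb', e'⟩ | ⟨hb', e'⟩) <;>
      have := hh (e.trans e'.symm) <;> cases i <;> simpa using this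
  have hPR : ∀ i b a, P i b a → R a b := by
    rintro i b a (⟨hb, e⟩ | ⟨hb, e⟩)
    · have := hhR (Sum.inl (if i then Sum.inl ⟨b, hb⟩ else Sum.inr ⟨b, hb⟩))
      rw [e] at this
      cases i <;> exact this
    · have := hhR (Sum.inr ⟨b, hb⟩)
      rw [e] at this
      cases i <;> exact this
  have hP1 : ∀ i, ∀ b ∈ B₁, ∃ a, P i b a := by
    intro i b hb
    cases i
    · obtain ⟨a, ha, -⟩ := hr b hb
      exact ⟨a, Or.inl ⟨hb, ha⟩⟩
    · obtain ⟨a, ha, -⟩ := hl b hb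
      exact ⟨a, Or.inl ⟨hb, ha⟩⟩
  have hP2 : ∀ b ∈ B₂, (∃ a, P true b a) ∨ ∃ a, P false b a := by
    intro b hb
    rcases hs b hb with ⟨a, ha, -⟩ | ⟨a, ha, -⟩
    · exact Or.inl ⟨a, Or.inr ⟨hb, ha⟩⟩
    · exact Or.inr ⟨a, Or.inr ⟨hb, ha⟩⟩
  have hchoose : ∀ i b, ∃ a, (∃ a, P i b a) → P i b a := by
    intro i b
    by_cases hex : ∃ a, P i b a
    · exact ⟨hex.choose, fun _ => hex.choose_spec⟩
    · exact ⟨Classical.arbitrary α, fun h => absurd h hex⟩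
  choose q hq using hchoose
  -- The matching into the first copy of `α` is absorbed into `m`; a vertex of `B₂` missed by `m`
  -- must therefore use the second copy, which supplies `n`.
  obtain ⟨m, hm, hmR, hmT⟩ := exists_injective_extending (T := {b | ∃ a, P true b a}) (g := q true)
    hf hfR (fun b hb b' hb' e => hPinj true b b' _ (hq true b hb) (e ▸ hq true b' hb'))
    (fun b hb => hPR true b _ (hq true b hb))
  have hdom : ∀ b, b ∈ B₁ ∨ b ∈ B₂ ∧ b ∉ Set.range m → ∃ a, P false b a := by
    rintro b (hb | ⟨hb, hbm⟩)
    · exact hP1 false b hb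
    · exact (hP2 b hb).resolve_left fun h => hbm (hmT h)
  exact ⟨m, q false, hm, hmR, fun b hb => hmT (hP1 true b hb),
    fun b hb => hPR false b _ (hq false b (hdom b hb)),
    fun b hb b' hb' e => hPinj false b b' _ (hq false b (hdom b hb))
      (e ▸ hq false b' (hdom b' hb'))⟩

/-! ### Counting small components -/

/-- `T` is the vertex set of a component of `G - X`. -/
def IsComponentSet (G : SimpleGraph V) (X T : Finset V) : Prop :=
  T.Nonempty ∧ Disjoint T X ∧ (∀ a ∈ T, ∀ b, G.Adj a b → b ∈ T ∨ b ∈ X) ∧ Linked G T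

/-- Closure keeps the component of a vertex of `T` inside `T`; linkedness makes it all of `T`. -/
theorem IsComponentSet.exists_connectedComponent {G : SimpleGraph V} {X T : Finset V}
    (h : IsComponentSet G X T) :
    ∃ C : (deleteVerts G (X : Set V)).ConnectedComponent, Subtype.val '' C.supp = (T : Set V) := by
  classical
  obtain ⟨⟨v, hv⟩, hdis, hcl, hlink⟩ := h
  have hX : ∀ a ∈ T, a ∈ ((X : Set V)ᶜ) := fun a ha =>
    by simpa using Finset.disjoint_left.1 hdis ha
  refine ⟨(deleteVerts G (X : Set V)).connectedComponentMk ⟨v, hX v hv⟩, ?_⟩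
  set C := (deleteVerts G (X : Set V)).connectedComponentMk ⟨v, hX v hv⟩
  have hsub : ∀ x, x ∈ Subtype.val '' C.supp → x ∈ T := by
    rintro _ ⟨x, hx, rfl⟩
    have hr : (deleteVerts G (X : Set V)).Reachable ⟨v, hX v hv⟩ x :=
      (SimpleGraph.ConnectedComponent.exact hx).symm
    obtain ⟨w⟩ := hr
    have : ∀ (a b : ((X : Set V)ᶜ : Set V)), (deleteVerts G (X : Set V)).Walk a b →
        (a : V) ∈ T → (b : V) ∈ T := by
      intro a b w
      induction w with
      | nil => exact id
      | @cons a c _ hadj _ ih =>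
        intro ha
        refine ih ((hcl a ha c hadj).resolve_right fun hc => ?_)
        exact c.2 hc
    exact this _ _ w hv
  have := hlink (T.filter fun x => x ∈ Subtype.val '' C.supp) (Finset.filter_subset _ _)
    ⟨v, Finset.mem_filter.2 ⟨hv, ⟨v, hX v hv⟩, rfl, rfl⟩⟩ ?_
  · ext x
    rw [Finset.mem_coe]
    refine ⟨hsub x, fun hx => ?_⟩
    rw [← this] at hx
    exact (Finset.mem_filter.1 hx).2
  · intro a ha b hb hab
    rw [Finset.mem_filter] at ha ⊢
    obtain ⟨-, a, ha, rfl⟩ := ha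
    refine ⟨hb, ⟨b, hX b hb⟩, ?_, rfl⟩
    have hadj : (deleteVerts G (X : Set V)).Adj ⟨b, hX b hb⟩ a := hab.symm
    exact (SimpleGraph.ConnectedComponent.sound hadj.reachable).trans ha

theorem card_filter_le_numComponents [Finite V] {G : SimpleGraph V} {X : Finset V}
    {ℐ : Finset (Finset V)} (h : ∀ T ∈ ℐ, IsComponentSet G X T) (i : ℕ) :
    (ℐ.filter fun T => T.card = i).card ≤ numComponents (deleteVerts G (X : Set V)) i := by
  classical
  -- `Option` supplies a default value, since there may be no components at all.
  have hC : ∀ T, ∃ C : Option (deleteVerts G (X : Set V)).ConnectedComponent, T ∈ ℐ →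
      ∃ D, C = some D ∧ Subtype.val '' D.supp = (T : Set V) := by
    intro T
    by_cases hT : T ∈ ℐ
    · obtain ⟨D, hD⟩ := (h T hT).exists_connectedComponent
      exact ⟨some D, fun _ => ⟨D, rfl, hD⟩⟩
    · exact ⟨none, fun h => absurd h hT⟩
  choose C hC using hC
  rw [numComponents, ← Set.ncard_image_of_injective _ (Option.some_injective _),
    ← Set.ncard_coe_finset]
  refine Set.ncard_le_ncard_of_injOn C ?_ ?_ (Set.toFinite _)
  · intro T hT
    obtain ⟨hT, hi⟩ := Finset.mem_filter.1 (Finset.mem_coe.1 hT)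
    obtain ⟨D, hD, hDT⟩ := hC T hT
    refine ⟨D, ?_, hD.symm⟩
    rw [Set.mem_ofPred_eq, ← Set.ncard_image_of_injective _ Subtype.val_injective, hDT,
      Set.ncard_coe_finset, hi]
  · intro T hT T' hT' e
    obtain ⟨D, hD, hDT⟩ := hC T (Finset.mem_filter.1 (Finset.mem_coe.1 hT)).1
    obtain ⟨D', hD', hDT'⟩ := hC T' (Finset.mem_filter.1 (Finset.mem_coe.1 hT')).1
    rw [hD, hD', Option.some_inj] at e
    rw [← Finset.coe_inj, ← hDT, ← hDT', e]

theorem sum_weight (ℐ : Finset (Finset V)) : ∑ T ∈ ℐ, weight T =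
    3 * (ℐ.filter fun T => T.card = 1).card + (ℐ.filter fun T => T.card = 3).card +
      (ℐ.filter fun T => T.card = 5).card := by
  simp only [Finset.card_filter]
  rw [Finset.mul_sum, ← Finset.sum_add_distrib, ← Finset.sum_add_distrib]
  refine Finset.sum_congr rfl fun T _ => ?_
  rw [weight]
  split_ifs <;> omega

/-- The weighted component condition of the main theorem, for families of components. -/
theorem sum_weight_le [Finite V] {G : SimpleGraph V}
    (hG : ∀ X : Set V, (numComponents (deleteVerts G X) 1 : ℝ)
      + (1 / 3 : ℝ) * (numComponents (deleteVerts G X) 3 : ℝ)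
      + (1 / 3 : ℝ) * (numComponents (deleteVerts G X) 5 : ℝ) ≤ (2 / 3 : ℝ) * (X.ncard : ℝ))
    {X : Finset V} {ℐ : Finset (Finset V)} (h : ∀ T ∈ ℐ, IsComponentSet G X T) :
    ∑ T ∈ ℐ, weight T ≤ 2 * X.card := by
  have h0 := hG X
  rw [Set.ncard_coe_finset] at h0
  have h1 := card_filter_le_numComponents h 1
  have h3 := card_filter_le_numComponents h 3
  have h5 := card_filter_le_numComponents h 5
  rw [sum_weight]
  have : 3 * numComponents (deleteVerts G (X : Set V)) 1 +
      numComponents (deleteVerts G (X : Set V)) 3 +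
      numComponents (deleteVerts G (X : Set V)) 5 ≤ 2 * X.card := by
    have : (3 * numComponents (deleteVerts G (X : Set V)) 1 +
      numComponents (deleteVerts G (X : Set V)) 3 +
      numComponents (deleteVerts G (X : Set V)) 5 : ℝ) ≤ 2 * X.card := by linarith
    exact_mod_cast this
  omega

/-! ### Neighbours of bad parts and the tilings that absorb them -/

section Assembly

variable [DecidableEq V] {G : SimpleGraph V}

/-- Factor-critical parts without a tiling have enough neighbours in the barrier. -/
theorem sum_demand_le [Fintype V] (hG : ∀ X : Set V, (numComponents (deleteVerts G X) 1 : ℝ)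
      + (1 / 3 : ℝ) * (numComponents (deleteVerts G X) 3 : ℝ)
      + (1 / 3 : ℝ) * (numComponents (deleteVerts G X) 5 : ℝ) ≤ (2 / 3 : ℝ) * (X.ncard : ℝ))
    {S : Finset V} {𝒯 : Finset (Finset V)} (hST : OddParts G univ S 𝒯)
    (hfc : ∀ T ∈ 𝒯, FactorCritical G T) (hbad : ∀ T ∈ 𝒯, ¬ Tileable G T) :
    ∃ N ⊆ S, ∑ T ∈ 𝒯, (if T.card = 1 then 2 else 1) ≤ 2 * N.card ∧
      ∀ s ∈ N, ∃ T ∈ 𝒯, ∃ t ∈ T, G.Adj s t := by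
  classical
  choose! U hU I hI hId hw using fun T hT => (hfc T hT).exists_heavy (hbad T hT)
  refine ⟨S.filter fun s => ∃ T ∈ 𝒯, ∃ t ∈ T, G.Adj s t, Finset.filter_subset _ _, ?_,
    fun s hs => (Finset.mem_filter.1 hs).2⟩
  set N := S.filter fun s => ∃ T ∈ 𝒯, ∃ t ∈ T, G.Adj s t with hN
  -- Delete all the sets `U T` and the neighbours `N` of the parts in `S`: the heavy pieces remain
  -- components. In the resulting inequality the terms `2|U T|` cancel, leaving the total demand at
  -- most `2|N|`.
  have hcomp : ∀ T ∈ 𝒯.biUnion I, IsComponentSet G (N ∪ 𝒯.biUnion U) T := by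
    intro T hT
    obtain ⟨C, hC, hTC⟩ := Finset.mem_biUnion.1 hT
    obtain ⟨h1, h2, h3, h4, h5⟩ := hI C hC T hTC
    obtain ⟨-, -, g3, g4⟩ := hST.1 C hC
    refine ⟨h2, ?_, ?_, h5⟩
    · rw [Finset.disjoint_union_right, Finset.disjoint_biUnion_right]
      refine ⟨(g3.mono_left h1).mono_right (Finset.filter_subset _ _), fun D hD => ?_⟩
      by_cases hCD : C = D
      · exact hCD ▸ h3
      · exact Disjoint.mono h1 (hU D hD) (hST.2 hC hD hCD)
    · intro a ha b hab
      rcases g4 a (h1 ha) b (Finset.mem_univ b) hab with hb | hb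
      · exact (h4 a ha b hb hab).imp_right fun h =>
          Finset.mem_union_right _ (Finset.mem_biUnion.2 ⟨C, hC, h⟩)
      · refine Or.inr (Finset.mem_union_left _ (Finset.mem_filter.2 ⟨hb, C, hC, a, h1 ha, hab.symm⟩))
  have hle := sum_weight_le hG hcomp
  rw [Finset.sum_biUnion] at hle
  · have h1 := Finset.sum_le_sum hw
    rw [Finset.sum_add_distrib, ← Finset.mul_sum] at h1
    have h2 := Finset.card_union_le N (𝒯.biUnion U)
    have h3 : (𝒯.biUnion U).card ≤ ∑ T ∈ 𝒯, (U T).card := Finset.card_biUnion_le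
    omega
  · intro C hC D hD hne
    rw [Function.onFun, Finset.disjoint_left]
    intro T hT hT'
    obtain ⟨h1, ⟨v, hv⟩, -⟩ := hI C hC T hT
    obtain ⟨h1', -⟩ := hI D hD T hT'
    exact Finset.disjoint_left.1 (hST.2 hC hD hne) (h1 hv) (h1' hv)

theorem Tileable.of_groups {ι κ : Type*} [DecidableEq ι] {a : ι → Finset V} {I : Finset ι}
    (hd : (I : Set ι).PairwiseDisjoint a) {E : Finset κ} {J : κ → Finset ι}
    (hJ : ∀ e ∈ E, J e ⊆ I) (hJd : (E : Set κ).PairwiseDisjoint J)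
    (hE : ∀ e ∈ E, Tileable G ((J e).biUnion a))
    (hrest : ∀ i ∈ I, (∀ e ∈ E, i ∉ J e) → Tileable G (a i)) : Tileable G (I.biUnion a) := by
  have hsub : E.biUnion J ⊆ I := Finset.biUnion_subset.2 hJ
  have hdis : ∀ K ⊆ I, ∀ L ⊆ I, Disjoint K L → Disjoint (K.biUnion a) (L.biUnion a) := by
    intro K hK L hL hKL
    rw [Finset.disjoint_biUnion_left]
    intro i hi
    rw [Finset.disjoint_biUnion_right]
    intro j hj
    exact hd (hK hi) (hL hj) (Finset.disjoint_iff_ne.1 hKL i hi j hj)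
  rw [← Finset.union_sdiff_of_subset hsub, Finset.union_biUnion]
  refine Tileable.union ?_ ?_ (hdis _ hsub _ Finset.sdiff_subset Finset.disjoint_sdiff)
  · rw [Finset.biUnion_biUnion]
    exact Tileable.biUnion hE fun e he e' he' hne => hdis _ (hJ e he) _ (hJ e' he') (hJd he he' hne)
  · refine Tileable.biUnion (fun i hi => ?_) (hd.subset (by simp))
    rw [Finset.mem_sdiff, Finset.mem_biUnion] at hi
    exact hrest i hi.1 fun e he hie => hi.2 ⟨e, he, hie⟩

theorem FactorCritical.matched_insert {T : Finset V} (h : FactorCritical G T) {s t : V}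
    (ht : t ∈ T) (hs : s ∉ T) (hst : G.Adj s t) : Matched G (insert s T) := by
  have := (matched_pair hst).union (h.2 t ht) (by
    rw [Finset.disjoint_left]
    intro v hv
    rw [Finset.mem_insert, Finset.mem_singleton] at hv
    rcases hv with rfl | rfl <;> simp [hs])
  convert this using 1
  ext v
  simp only [Finset.mem_insert, Finset.mem_union, Finset.mem_singleton, Finset.mem_erase]
  grind

/-- Follow any edge from `t` to `x`, then the edge from `x` in the matching missing `t`; that
matching still covers the rest. -/
theorem FactorCritical.exists_path_three {T : Finset V} (h : FactorCritical G T)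
    (hT : T.card ≠ 1) {t : V} (ht : t ∈ T) : ∃ x ∈ T, ∃ y ∈ T, x ≠ t ∧ y ≠ t ∧ x ≠ y ∧
      G.Adj t x ∧ G.Adj x y ∧ Matched G (T \ {t, x, y}) := by
  obtain ⟨μ, hμ⟩ := h.2 t ht
  have hμ' := IsPartner.erase_iff.1 hμ
  obtain ⟨g, hg, x, hx, hxt, hgx⟩ := h.linked.exists_adj (W := {t}) (by simpa using ht) (by simp)
    (by
      rw [Finset.card_singleton]
      have := Finset.card_pos.2 ⟨t, ht⟩
      omega)
  rw [Finset.mem_singleton] at hg hxt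
  subst hg
  obtain ⟨h1, h2, h3, h4, h5⟩ := hμ' x hx hxt
  refine ⟨x, hx, μ x, h1, hxt, h2, h3.symm, hgx, h5, IsPartner.matched_subset hμ ?_ ?_⟩
  · intro v hv
    simp only [Finset.mem_sdiff, Finset.mem_insert, not_or] at hv
    exact Finset.mem_erase.2 ⟨hv.2.1, hv.1⟩
  · intro v hv
    simp only [Finset.mem_sdiff, Finset.mem_insert, Finset.mem_singleton] at hv ⊢
    have := hμ' v
    grind

theorem tileable_of_seven_union {A M : Finset V} {l : List V} (hl : l.length = 7)
    (hnd : l.Nodup) (hc : l.IsChain G.Adj) (hM : Matched G M) (hlM : ∀ x ∈ l, x ∉ M)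
    (hA : ∀ x, x ∈ A ↔ x ∈ l ∨ x ∈ M) : Tileable G A := by
  have := (isPiece_seven hl hnd hc).tileable.union hM.tileable (by
    rw [Finset.disjoint_left]
    exact fun x hx => hlM x (List.mem_toFinset.1 hx))
  convert this using 1
  ext x
  rw [hA, Finset.mem_union, List.mem_toFinset]

/-- The `P₇` has `s` in the middle and three vertices in each part. -/
theorem tileable_two_parts {C D : Finset V} (hC : FactorCritical G C) (hC1 : C.card ≠ 1)
    (hD : FactorCritical G D) (hD1 : D.card ≠ 1) (hCD : Disjoint C D) {s c d : V} (hsC : s ∉ C)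
    (hsD : s ∉ D) (hc : c ∈ C) (hd : d ∈ D) (hsc : G.Adj s c) (hsd : G.Adj s d) :
    Tileable G (C ∪ insert s D) := by
  obtain ⟨x, hx, y, hy, hxc, hyc, hxy, h1, h2, h3⟩ := hC.exists_path_three hC1 hc
  obtain ⟨x', hx', y', hy', hxc', hyc', hxy', h1', h2', h3'⟩ := hD.exists_path_three hD1 hd
  have hdis : ∀ v, v ∈ C → v ∉ D := fun v => fun h => Finset.disjoint_left.1 hCD h
  have e1 := h1.symm
  have e2 := h2.symm
  have e3 := hsc.symm
  refine tileable_of_seven_union (l := [y, x, c, s, d, x', y']) rfl ?_ ?_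
    (h3.union h3' (hCD.mono Finset.sdiff_subset Finset.sdiff_subset)) ?_ ?_
  · have := hdis x hx
    have := hdis y hy
    have := hdis c hc
    simp only [List.nodup_cons, List.mem_cons, List.not_mem_nil, or_false, not_or]
    and_intros <;> first
      | exact List.nodup_nil
      | exact not_false
      | assumption
      | exact Ne.symm (by assumption)
      | (rintro rfl; contradiction)
  · simp only [List.isChain_cons_cons, List.IsChain.singleton]
    and_intros <;> trivial
  · intro v hv
    simp only [List.mem_cons, List.not_mem_nil, or_false] at hv
    simp only [Finset.mem_union, Finset.mem_sdiff, Finset.mem_insert, Finset.mem_singleton]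
    have := hdis v
    grind
  · intro v
    simp only [Finset.mem_union, Finset.mem_sdiff, Finset.mem_insert, Finset.mem_singleton,
      List.mem_cons, List.not_mem_nil, or_false]
    grind

/-- The `P₇` uses three vertices of `C`, then `s, t, r, d`. Since only `d` is taken from `D`, this
part may be a singleton. -/
theorem tileable_part_singleton_part {C D : Finset V} (hC : FactorCritical G C)
    (hC1 : C.card ≠ 1) (hD : FactorCritical G D) (hCD : Disjoint C D) {s t r c d : V}
    (hsC : s ∉ C) (hsD : s ∉ D) (htC : t ∉ C) (htD : t ∉ D) (hrC : r ∉ C) (hrD : r ∉ D)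
    (hsr : s ≠ r) (hc : c ∈ C) (hd : d ∈ D) (hsc : G.Adj s c) (hst : G.Adj s t)
    (hrt : G.Adj r t) (hrd : G.Adj r d) : Tileable G (C ∪ (insert s {t} ∪ insert r D)) := by
  obtain ⟨x, hx, y, hy, hxc, hyc, hxy, h1, h2, h3⟩ := hC.exists_path_three hC1 hc
  have hdis : ∀ v, v ∈ C → v ∉ D := fun v => fun h => Finset.disjoint_left.1 hCD h
  have e1 := h1.symm
  have e2 := h2.symm
  have e3 := hsc.symm
  have e4 := hrt.symm
  refine tileable_of_seven_union (l := [y, x, c, s, t, r, d]) rfl ?_ ?_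
    (h3.union (hD.2 d hd) (hCD.mono Finset.sdiff_subset (Finset.erase_subset _ _))) ?_ ?_
  · have := hdis x hx
    have := hdis y hy
    have := hdis c hc
    have := hst.ne
    have := hrt.ne
    simp only [List.nodup_cons, List.mem_cons, List.not_mem_nil, or_false, not_or]
    and_intros <;> first
      | exact List.nodup_nil
      | exact not_false
      | assumption
      | exact Ne.symm (by assumption)
      | (rintro rfl; contradiction)
  · simp only [List.isChain_cons_cons, List.IsChain.singleton]
    and_intros <;> trivial
  · intro v hv
    simp only [List.mem_cons, List.not_mem_nil, or_false] at hv
    simp only [Finset.mem_union, Finset.mem_sdiff, Finset.mem_insert, Finset.mem_singleton,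
      Finset.mem_erase]
    have := hdis v
    grind
  · intro v
    simp only [Finset.mem_union, Finset.mem_sdiff, Finset.mem_insert, Finset.mem_singleton,
      List.mem_cons, List.not_mem_nil, or_false, Finset.mem_erase]
    grind

end Assembly

theorem Tileable.card_ne_one [DecidableEq V] {G : SimpleGraph V} {A : Finset V}
    (h : Tileable G A) : A.card ≠ 1 := by
  intro hA
  obtain ⟨v, rfl⟩ := Finset.card_eq_one.1 hA
  obtain ⟨P, hP, -, hun⟩ := h
  obtain ⟨p, hp, hvp⟩ := Finset.mem_biUnion.1 (hun ▸ Finset.mem_singleton_self v)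
  obtain ⟨n, hn, f, hinj, -, hmem⟩ := hP p hp
  have hf : ∀ i, f i = v := fun i => by
    have : f i ∈ P.biUnion id := Finset.mem_biUnion.2 ⟨p, hp, (hmem _).2 ⟨i, rfl⟩⟩
    rwa [hun, Finset.mem_singleton] at this
  have := hinj ((hf ⟨0, by omega⟩).trans (hf ⟨1, by omega⟩).symm)
  simp at this

/-! ### Combining the two matchings -/

/-- The two matchings between the barrier and the parts combine to a tiling of the whole graph. -/
theorem tileable_of_two_matchings [Fintype V] [DecidableEq V] {G : SimpleGraph V} {S : Finset V}
    {𝒯 : Finset (Finset V)} (hST : OddParts G univ S 𝒯) (hfc : ∀ T ∈ 𝒯, FactorCritical G T)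
    (hrest : Matched G (univ \ (S ∪ 𝒯.biUnion id))) {m : S → Finset V} {n : Finset V → S}
    (hm : Injective m) (hmR : ∀ s : S, m s ∈ 𝒯 ∧ ∃ t ∈ m s, G.Adj s t)
    (hm1 : ∀ T ∈ 𝒯, T.card = 1 → T ∈ Set.range m)
    (hnR : ∀ T ∈ 𝒯, T.card = 1 ∨ ¬ Tileable G T ∧ T ∉ Set.range m → ∃ t ∈ T, G.Adj (n T) t)
    (hn : Set.InjOn n {T | T ∈ 𝒯 ∧ (T.card = 1 ∨ ¬ Tileable G T ∧ T ∉ Set.range m)}) :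
    Tileable G univ := by
  classical
  have hS : ∀ s : S, ∀ T ∈ 𝒯, (s : V) ∉ T := fun s T hT hs =>
    Finset.disjoint_left.1 (hST.1 T hT).2.2.1 hs s.2
  -- Blocks: each barrier vertex with its part under `m`, and each part missed by `m` alone.
  let a : S ⊕ Finset V → Finset V := Sum.elim (fun s => insert (s : V) (m s)) id
  let I : Finset (S ⊕ Finset V) := univ.disjSum (𝒯.filter fun T => T ∉ Set.range m)
  have hI : ∀ T, Sum.inr T ∈ I ↔ T ∈ 𝒯 ∧ T ∉ Set.range m := fun T => by simp [I]
  have hI' : ∀ s, Sum.inl s ∈ I := fun s => by simp [I]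
  have hsT : ∀ (s : S) T, T ∈ 𝒯 → T ≠ m s → Disjoint (insert (s : V) (m s)) T := by
    intro s T hT hne
    rw [Finset.disjoint_insert_left]
    exact ⟨hS s T hT, hST.2 (hmR s).1 hT hne.symm⟩
  have hd : (I : Set (S ⊕ Finset V)).PairwiseDisjoint a := by
    rintro (s | T) hi (s' | T') hj hne
    · have hss : s ≠ s' := fun e => hne (by rw [e])
      change Disjoint (insert (s : V) (m s)) (insert (s' : V) (m s'))
      rw [Finset.disjoint_insert_right]
      refine ⟨?_, hsT s _ (hmR s').1 (fun e => hss (hm e).symm)⟩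
      rw [Finset.mem_insert, not_or]
      exact ⟨fun e => hss (Subtype.ext e.symm), hS s' _ (hmR s).1⟩
    · have := (hI T').1 hj
      exact hsT s T' this.1 fun e => this.2 ⟨s, e.symm⟩
    · have := (hI T).1 hi
      exact (hsT s' T this.1 fun e => this.2 ⟨s', e.symm⟩).symm
    · exact hST.2 ((hI T).1 hi).1 ((hI T').1 hj).1 fun e => hne (congrArg Sum.inr e)
  have key : Tileable G (I.biUnion a) := by
    let E : Finset (Finset V) := 𝒯.filter fun T => ¬ Tileable G T ∧ T ∉ Set.range m
    have hE : ∀ {T}, T ∈ E ↔ T ∈ 𝒯 ∧ ¬ Tileable G T ∧ T ∉ Set.range m := Finset.mem_filter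
    have hE1 : ∀ T ∈ E, T.card ≠ 1 := fun T hT h => (hE.1 hT).2.2 (hm1 T (hE.1 hT).1 h)
    have hnE : ∀ T ∈ E, ∀ T' ∈ E, n T = n T' → T = T' := fun T hT T' hT' e =>
      hn ⟨(hE.1 hT).1, Or.inr (hE.1 hT).2⟩ ⟨(hE.1 hT').1, Or.inr (hE.1 hT').2⟩ e
    have hn1 : ∀ s s', (m s).card = 1 → (m s').card = 1 → n (m s) = n (m s') → s = s' :=
      fun s s' h h' e => hm (hn ⟨(hmR s).1, Or.inl h⟩ ⟨(hmR s').1, Or.inl h'⟩ e)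
    have hnE1 : ∀ T ∈ E, ∀ s, (m s).card = 1 → n T ≠ n (m s) := fun T hT s h e =>
      (hE.1 hT).2.2 ⟨s, (hn ⟨(hE.1 hT).1, Or.inr (hE.1 hT).2⟩ ⟨(hmR s).1, Or.inl h⟩ e).symm⟩
    -- A bad block `T` is grouped with the block of `n T` and, when that block's part is a
    -- singleton, also with the block of the second barrier vertex serving this singleton.
    -- Injectivity of `n` and `m` keeps the groups disjoint.
    let J : Finset V → Finset (S ⊕ Finset V) := fun T => if (m (n T)).card = 1 then
      {Sum.inr T, Sum.inl (n T), Sum.inl (n (m (n T)))} else {Sum.inr T, Sum.inl (n T)}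
    have hJ : ∀ T i, i ∈ J T ↔ i = Sum.inr T ∨ i = Sum.inl (n T) ∨
        ((m (n T)).card = 1 ∧ i = Sum.inl (n (m (n T)))) := by
      intro T i
      by_cases h : (m (n T)).card = 1 <;> simp [J, h]
    refine Tileable.of_groups hd (E := E) (J := J) ?_ ?_ ?_ ?_
    · intro T hT i hi
      rcases (hJ T i).1 hi with rfl | rfl | ⟨-, rfl⟩
      · exact (hI T).2 ⟨(hE.1 hT).1, (hE.1 hT).2.2⟩
      · exact hI' _
      · exact hI' _
    · intro T hT T' hT' hne
      rw [Function.onFun, Finset.disjoint_left]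
      intro i hi hi'
      rw [hJ] at hi hi'
      apply hne
      rcases hi with rfl | rfl | ⟨h, rfl⟩ <;> rcases hi' with e | e | ⟨h', e⟩ <;>
        first
          | exact Sum.inr_injective e
          | exact absurd e Sum.inl_ne_inr
          | exact absurd e Sum.inr_ne_inl
          | replace e := Sum.inl_injective e
      · exact hnE T hT T' hT' e
      · exact absurd e (hnE1 T hT _ h')
      · exact absurd e.symm (hnE1 T' hT' _ h)
      · exact hnE T hT T' hT' (hn1 _ _ h h' e)
    · intro T hT
      obtain ⟨hT𝒯, hTt, hTr⟩ := hE.1 hT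
      obtain ⟨c, hc, hsc⟩ := hnR T hT𝒯 (Or.inr ⟨hTt, hTr⟩)
      obtain ⟨hmT, d, hd', hsd⟩ := hmR (n T)
      by_cases h : (m (n T)).card = 1
      · obtain ⟨r, hr⟩ : ∃ r, r = n (m (n T)) := ⟨_, rfl⟩
        obtain ⟨t, ht⟩ := Finset.card_eq_one.1 h
        obtain ⟨t', ht', hrt⟩ := hnR _ hmT (Or.inl h)
        obtain ⟨hmr, d', hd'', hrd⟩ := hmR r
        rw [← hr] at hrt
        rw [ht, Finset.mem_singleton] at hd' ht'
        subst hd' ht'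
        have hnr : n T ≠ r := hr ▸ hnE1 T hT (n T) h
        have htm : t' ∈ m (n T) := by rw [ht]; exact Finset.mem_singleton_self _
        have hJT : (J T).biUnion a = T ∪ (insert (n T : V) {t'} ∪ insert (r : V) (m r)) := by
          simp only [J, h, if_true, Finset.biUnion_insert, Finset.singleton_biUnion, a,
            Sum.elim_inl, Sum.elim_inr, id, ← hr]
          rw [ht]
        rw [hJT]
        exact tileable_part_singleton_part (hfc T hT𝒯) (hE1 T hT) (hfc _ hmr)
          (hST.2 hT𝒯 hmr fun e => hTr ⟨r, e.symm⟩) (hS _ _ hT𝒯) (hS _ _ hmr)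
          (Finset.disjoint_left.1 (hST.2 hmT hT𝒯 fun e => hTr ⟨_, e⟩) htm)
          (Finset.disjoint_left.1 (hST.2 hmT hmr fun e => hnr (hm e)) htm)
          (hS _ _ hT𝒯) (hS _ _ hmr) (fun e => hnr (Subtype.ext e)) hc hd'' hsc hsd hrt hrd
      · have hJT : (J T).biUnion a = T ∪ insert (n T : V) (m (n T)) := by
          simp only [J, h, if_false, Finset.biUnion_insert, Finset.singleton_biUnion, a,
            Sum.elim_inl, Sum.elim_inr, id]
        rw [hJT]
        exact tileable_two_parts (hfc T hT𝒯) (hE1 T hT) (hfc _ hmT) h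
          (hST.2 hT𝒯 hmT fun e => hTr ⟨_, e.symm⟩) (hS _ _ hT𝒯) (hS _ _ hmT) hc hd' hsc hsd
    · rintro (s | T) hi hout
      · obtain ⟨hms, t, ht, hst⟩ := hmR s
        exact ((hfc _ hms).matched_insert ht (hS s _ hms) hst).tileable
      · obtain ⟨hT, hTr⟩ := (hI T).1 hi
        by_contra hbad
        exact hout T (hE.2 ⟨hT, hbad, hTr⟩) ((hJ T _).2 (Or.inl rfl))
  have hun : I.biUnion a = S ∪ 𝒯.biUnion id := by
    ext v
    simp only [Finset.mem_biUnion, Finset.mem_union, id]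
    constructor
    · rintro ⟨s | T, hi, hv⟩
      · rcases Finset.mem_insert.1 hv with rfl | hv
        · exact Or.inl s.2
        · exact Or.inr ⟨m s, (hmR s).1, hv⟩
      · exact Or.inr ⟨T, ((hI T).1 hi).1, hv⟩
    · rintro (hv | ⟨T, hT, hv⟩)
      · exact ⟨Sum.inl ⟨v, hv⟩, hI' _, Finset.mem_insert_self _ _⟩
      · by_cases hTr : T ∈ Set.range m
        · obtain ⟨s, rfl⟩ := hTr
          exact ⟨Sum.inl s, hI' _, Finset.mem_insert_of_mem hv⟩
        · exact ⟨Sum.inr T, (hI T).2 ⟨hT, hTr⟩, hv⟩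
  have := key.union hrest.tileable (by rw [hun]; exact Finset.disjoint_sdiff)
  rwa [hun, Finset.union_sdiff_of_subset (Finset.subset_univ _)] at this

theorem tileable_univ [Fintype V] [DecidableEq V] {G : SimpleGraph V}
    (hG : ∀ X : Set V, (numComponents (deleteVerts G X) 1 : ℝ)
      + (1 / 3 : ℝ) * (numComponents (deleteVerts G X) 3 : ℝ)
      + (1 / 3 : ℝ) * (numComponents (deleteVerts G X) 5 : ℝ) ≤ (2 / 3 : ℝ) * (X.ncard : ℝ)) :
    Tileable G univ := by
  classical
  obtain ⟨S, 𝒯, hST, hfc, hrest, hhall⟩ := exists_decomposition G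
  have hdem : ∀ A ⊆ 𝒯, (∀ T ∈ A, ¬ Tileable G T) → ∃ N ⊆ S,
      ∑ T ∈ A, (if T.card = 1 then 2 else 1) ≤ 2 * N.card ∧
      ∀ s ∈ N, ∃ T ∈ A, ∃ t ∈ T, G.Adj s t := by
    intro A hA hbad
    exact sum_demand_le hG ⟨fun T hT => hST.1 T (hA hT), hST.2.subset (Finset.coe_subset.2 hA)⟩
      (fun T hT => hfc T (hA hT)) hbad
  -- With an empty barrier the demand bound leaves no untileable part. Otherwise `S` is inhabited,
  -- as `exists_two_matchings` requires.
  rcases S.eq_empty_or_nonempty with rfl | ⟨s₀, hs₀⟩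
  · have hgood : ∀ T ∈ 𝒯, Tileable G T := by
      intro T hT
      by_contra hbad
      obtain ⟨N, hN, hle, -⟩ := hdem {T} (by simpa using hT) (by simpa using hbad)
      rw [Finset.subset_empty.1 hN, Finset.sum_singleton, Finset.card_empty] at hle
      split_ifs at hle <;> omega
    have := (Tileable.biUnion (A := id) hgood hST.2).union hrest.tileable
      (by rw [Finset.empty_union]; exact Finset.disjoint_sdiff)
    rwa [Finset.empty_union, Finset.union_sdiff_of_subset (Finset.subset_univ _)] at this
  have : Nonempty S := ⟨⟨s₀, hs₀⟩⟩
  have hB : ∀ A₁ ⊆ 𝒯.filter (fun T => T.card = 1),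
      ∀ A₂ ⊆ 𝒯.filter (fun T => T.card ≠ 1 ∧ ¬ Tileable G T), ∃ N : Finset S,
      2 * A₁.card + A₂.card ≤ 2 * N.card ∧
        ∀ s ∈ N, ∃ T ∈ A₁ ∪ A₂, T ∈ 𝒯 ∧ ∃ t ∈ T, G.Adj s t := by
    intro A₁ hA₁ A₂ hA₂
    have h1 := fun T (hT : T ∈ A₁) => Finset.mem_filter.1 (hA₁ hT)
    have h2 := fun T (hT : T ∈ A₂) => Finset.mem_filter.1 (hA₂ hT)
    have hA : A₁ ∪ A₂ ⊆ 𝒯 := Finset.union_subset (fun T hT => (h1 T hT).1) fun T hT => (h2 T hT).1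
    obtain ⟨N, hN, hle, hadj⟩ := hdem (A₁ ∪ A₂) hA (by
      intro T hT
      rcases Finset.mem_union.1 hT with hT | hT
      · exact fun h => h.card_ne_one (h1 T hT).2
      · exact (h2 T hT).2.2)
    rw [Finset.sum_union (Finset.disjoint_left.2 fun T hT hT' => (h2 T hT').2.1 (h1 T hT).2),
      Finset.sum_congr rfl (fun T hT => if_pos (h1 T hT).2),
      Finset.sum_congr rfl (fun T hT => if_neg (h2 T hT).2.1)] at hle
    refine ⟨N.subtype (· ∈ S), ?_, fun s hs => ?_⟩
    · rw [Finset.card_subtype, Finset.filter_true_of_mem hN]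
      simp only [Finset.sum_const, smul_eq_mul] at hle
      omega
    · obtain ⟨T, hT, h⟩ := hadj s (Finset.mem_subtype.1 hs)
      exact ⟨T, hT, hA hT, h⟩
  obtain ⟨m, n, hm, hmR, hm1, hnR, hn⟩ := exists_two_matchings
    (R := fun (s : S) (T : Finset V) => T ∈ 𝒯 ∧ ∃ t ∈ T, G.Adj s t) (by
      intro A
      obtain ⟨N, hN, hle, hadj⟩ := hhall (A.map (Embedding.subtype _)) (by
        intro v hv
        obtain ⟨s, -, rfl⟩ := Finset.mem_map.1 hv
        exact s.2)
      rw [Finset.card_map] at hle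
      refine ⟨N, hle, fun T hT => ?_⟩
      obtain ⟨v, hv, t, ht, hvt⟩ := hadj T hT
      obtain ⟨s, hs, rfl⟩ := Finset.mem_map.1 hv
      exact ⟨s, hs, hN hT, t, ht, hvt⟩) hB
  have hdom : ∀ T ∈ 𝒯, T.card = 1 ∨ ¬ Tileable G T ∧ T ∉ Set.range m →
      T ∈ 𝒯.filter (fun T => T.card = 1) ∨
        T ∈ 𝒯.filter (fun T => T.card ≠ 1 ∧ ¬ Tileable G T) ∧ T ∉ Set.range m := by
    intro T hT h
    by_cases h1 : T.card = 1
    · exact Or.inl (Finset.mem_filter.2 ⟨hT, h1⟩)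
    · obtain ⟨h2, h3⟩ := h.resolve_left h1
      exact Or.inr ⟨Finset.mem_filter.2 ⟨hT, h1, h2⟩, h3⟩
  exact tileable_of_two_matchings hST hfc hrest hm hmR
    (fun T hT h => hm1 T (Finset.mem_filter.2 ⟨hT, h⟩))
    (fun T hT h => (hnR T (hdom T hT h)).2)
    (fun T hT T' hT' e => hn (hdom T hT.1 hT.2) (hdom T' hT'.1 hT'.2) e)

end PathFactor

theorem theorem1p1 {V : Type*} [Finite V] (G : SimpleGraph V)
    (hG : ∀ X : Set V,
      (PathFactor.numComponents (PathFactor.deleteVerts G X) 1 : ℝ)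
        + (1 / 3 : ℝ) * (PathFactor.numComponents (PathFactor.deleteVerts G X) 3 : ℝ)
        + (1 / 3 : ℝ) * (PathFactor.numComponents (PathFactor.deleteVerts G X) 5 : ℝ)
        ≤ (2 / 3 : ℝ) * (X.ncard : ℝ)) :
    ∃ F : SimpleGraph V, PathFactor.IsFactor {PathFactor.path 2, PathFactor.path 7} G F := by
  classical
  have := Fintype.ofFinite V
  exact (PathFactor.tileable_univ hG).exists_isFactor
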